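/- **Setting.** Let $A\in\mathbb R^{m\times n}$, let $k\ge 1$ and $q\ge k$ be integers, and let $\|\cdot\|$ be the Euclidean norm. For a vector $z$ and an integer $t\ge 0$, let $\mathcal H_t(z)$ be the vector that keeps $t$ entries of $z$ of largest magnitude (all of them if $t$ exceeds the dimension; ties broken arbitrarily) and sets the others to zero, and let $\mathcal L_t(z)=\operatorname{supp}\mathcal H_t(z)$. Let $\delta_t$ be the restricted isometry constant of $A$ of order $t$, i.e. the smallest $\delta\ge 0$ such that $(1-\delta)\|v\|^2\le\|Av\|^2\le(1+\delta)\|v\|^2$ for all $v\in\mathbb R^n$ with at most $t$ nonzero entries. Put $\varphi=\frac{1+\sqrt5}{2}$ and $c=\sqrt{\lceil n/k\rceil}$. For $\Omega\subseteq\{1,\dots,n\}$, and parameters $\alpha,\gamma>0$, let $M(\Omega)\in\mathbb R^{n\times n}$ have the $\Omega\times\Omega$ block $(A_\Omega^\top A_\Omega)^{-1}$ (where $A_\Omega$ consists of the columns of $A$ indexed by $\Omega$), the diagonal entries $\alpha$ outside $\Omega$, and zeros elsewhere; let $Z(\Omega)$ be the diagonal matrix with entries $1$ on $\Omega$ and $\gamma$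 outside $\Omega$. **Algorithm (CNOTP)** with input $A$, $y\in\mathbb R^m$, $k$, $q$, and stepsize $\lambda$. Start with $x^{(0)}=0$ and, for $p=0,1,2,\dots$, let $$\Omega^p=\mathcal L_q\big(A^\top(y-Ax^{(p)})\big),\qquad u^{(p)}=x^{(p)}+\lambda M(\Omega^p)Z(\Omega^p)A^\top(y-Ax^{(p)}),$$ $$w^{(p)}\in\arg\min_w\Big\{\|y-A(w\otimes u^{(p)})\|^2:\ \textstyle\sum_i w_i=k,\ 0\le w_i\le 1\Big\},$$ $$S^{(p+1)}=\mathcal L_k\big(w^{(p)}\otimes u^{(p)}\big),\qquad x^{(p+1)}\in\arg\min_z\big\{\|y-Az\|^2:\ \operatorname{supp}(z)\subseteq S^{(p+1)}\big\},$$ where $\otimes$ is the entrywise product. **Theorem (CNOTP convergence).** Let $y=Ax+\eta$ with $x\in\mathbb R^n$ and $\eta\in\mathbb R^m$. Let $S=\mathcal L_k(x)$, let $x_S$ (resp. $x_{\overline S}$) be the vector that agrees with $x$ on $S$ (resp. off $S$) and is zero elsewhere, and let $\eta'=Ax_{\overline S}+\eta$. Suppose that $$\delta_{\max\{q,3k\}}<\frac{-(1+6\varphi)+\sqrt{(1+6\varphi)^2+12\varphi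 c}}{6\varphi c},$$ that $$(1+\delta_q)\left(1-\frac{\frac1{3\varphi}(1-\delta_{2k})-\delta_{3k}}{1+c\,\delta_{3k}}\right)<\lambda<(1-\delta_q)\left(1+\frac{\frac1{3\varphi}(1-\delta_{2k})-\delta_{3k}}{1+c\,\delta_{3k}}\right),$$ and that $\frac1{1+\delta_q}\le\alpha\gamma\le\frac1{1-\delta_q}$. Put $\Delta=\max\left\{\left|1-\frac{\lambda}{1-\delta_q}\right|,\left|1-\frac{\lambda}{1+\delta_q}\right|\right\}$ and $$\rho_4=\frac{3\varphi}{1-\delta_{2k}}\big(\delta_{3k}+\Delta(1+c\,\delta_{3k})\big),\qquad \tau_4=\frac{3\lambda\varphi(1+\delta_k)c}{(1-\delta_q)(1-\delta_{2k})\sqrt{1+\delta_{2k}}}+\frac{2\varphi}{(1-\delta_{2k})\sqrt{1+\delta_{2k}}}+\frac{\sqrt{1+\delta_k}}{1-\delta_{2k}}.$$ Then $\rho_4<1$, and every sequence $(x^{(p)})$ generated by CNOTP satisfies, for all $p\ge 0$, $$\|x^{(p+1)}-x_S\|\le\rho_4\|x^{(p)}-x_S\|+\tau_4\|\eta'\|.$$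 In particular, if $\eta'=0$, then $x^{(p)}\to x_S$ as $p\to\infty$. -/

import Mathlib

open scoped Matrix

noncomputable section

/-- The index set of nonzero entries of a vector. -/
def supp {n : ℕ} (x : EuclideanSpace ℝ (Fin n)) : Finset (Fin n) :=
  Finset.univ.filter fun i => x i ≠ 0

/-- A vector is `t`-sparse if it has at most `t` nonzero entries. -/
def IsSparse {n : ℕ} (t : ℕ) (x : EuclideanSpace ℝ (Fin n)) : Prop :=
  (supp x).card ≤ t

/-- The vector that keeps the entries of `x` in `S` and is zero elsewhere. -/
def restrictTo {n : ℕ} (S : Finset (Fin n)) (x : EuclideanSpace ℝ (Fin n)) :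
    EuclideanSpace ℝ (Fin n) :=
  WithLp.toLp 2 fun i => if i ∈ S then x i else 0

/-- The entrywise product of two vectors. -/
def hadamard {n : ℕ} (w u : EuclideanSpace ℝ (Fin n)) : EuclideanSpace ℝ (Fin n) :=
  WithLp.toLp 2 fun i => w i * u i

/-- The matrix-vector product, between Euclidean spaces. -/
def mulE {m n : ℕ} (A : Matrix (Fin m) (Fin n) ℝ) (x : EuclideanSpace ℝ (Fin n)) :
    EuclideanSpace ℝ (Fin m) :=
  WithLp.toLp 2 (A *ᵥ fun i => x i)

/-- The restricted isometry constant of order `t`: the smallest `δ ≥ 0` with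
`(1 - δ) ‖x‖² ≤ ‖A x‖² ≤ (1 + δ) ‖x‖²` for all `t`-sparse `x`.
The set below is never empty, and its infimum is attained; it is less than `1` exactly when
the matrix has the restricted isometry property of order `t`. -/
def ric {m n : ℕ} (A : Matrix (Fin m) (Fin n) ℝ) (t : ℕ) : ℝ :=
  sInf {δ : ℝ | 0 ≤ δ ∧ ∀ x : EuclideanSpace ℝ (Fin n), IsSparse t x →
    (1 - δ) * ‖x‖ ^ 2 ≤ ‖mulE A x‖ ^ 2 ∧ ‖mulE A x‖ ^ 2 ≤ (1 + δ) * ‖x‖ ^ 2}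

/-- `h` is a value of the hard thresholding operator of order `t` at `z`: it keeps `t` entries of
`z` of largest magnitude (all entries, if `t` exceeds the dimension) and is zero elsewhere.
Ties may be broken in any way. -/
def IsHardThreshold {n : ℕ} (t : ℕ) (z h : EuclideanSpace ℝ (Fin n)) : Prop :=
  ∃ T : Finset (Fin n), T.card = min t n ∧ (∀ i ∈ T, ∀ j ∉ T, |z j| ≤ |z i|) ∧
    h = restrictTo T z

/-- `S` is the support of the hard thresholding of order `t` of `z`. -/
def IsThresholdSupport {n : ℕ} (t : ℕ) (z : EuclideanSpace ℝ (Fin n)) (S : Finset (Fin n)) :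
    Prop :=
  ∃ h, IsHardThreshold t z h ∧ S = supp h

/-- The submatrix of the columns of `A` indexed by `Ω`. -/
def colSub {m n : ℕ} (A : Matrix (Fin m) (Fin n) ℝ) (Ω : Finset (Fin n)) :
    Matrix (Fin m) Ω ℝ :=
  A.submatrix id Subtype.val

/-- The matrix `M(Ω)`: its `Ω × Ω` block is `(A_Ωᵀ A_Ω)⁻¹`, its diagonal entries outside `Ω` are
`α`, and all its other entries are zero. -/
def newtonMatrix {m n : ℕ} (A : Matrix (Fin m) (Fin n) ℝ) (α : ℝ) (Ω : Finset (Fin n)) :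
    Matrix (Fin n) (Fin n) ℝ :=
  Matrix.of fun i j =>
    if h : i ∈ Ω ∧ j ∈ Ω then ((colSub A Ω)ᵀ * colSub A Ω)⁻¹ ⟨i, h.1⟩ ⟨j, h.2⟩
    else if i = j then α else 0

/-- The diagonal matrix `Z(Ω)`, with entries `1` on `Ω` and `γ` outside `Ω`. -/
def scalingMatrix {n : ℕ} (γ : ℝ) (Ω : Finset (Fin n)) : Matrix (Fin n) (Fin n) ℝ :=
  Matrix.diagonal fun i => if i ∈ Ω then 1 else γ

/-- The compressed Newton update `x + λ M(Ω) Z(Ω) Aᵀ (y - A x)`. -/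
def newtonUpdate {m n : ℕ} (A : Matrix (Fin m) (Fin n) ℝ) (y : EuclideanSpace ℝ (Fin m))
    (lam α γ : ℝ) (Ω : Finset (Fin n)) (x : EuclideanSpace ℝ (Fin n)) :
    EuclideanSpace ℝ (Fin n) :=
  x + lam • mulE (newtonMatrix A α Ω) (mulE (scalingMatrix γ Ω) (mulE Aᵀ (y - mulE A x)))

/-- `v` minimizes `f` over the set `C`. -/
def IsArgmin {E : Type*} (f : E → ℝ) (C : Set E) (v : E) : Prop :=
  v ∈ C ∧ ∀ z ∈ C, f v ≤ f z

/-- The weights `w` with `0 ≤ w ≤ 1` entrywise and `∑ wᵢ = k`. -/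
def weightSet (n k : ℕ) : Set (EuclideanSpace ℝ (Fin n)) :=
  {w | ∑ i, w i = (k : ℝ) ∧ ∀ i, 0 ≤ w i ∧ w i ≤ 1}

/-- One iteration of CNOTP leads from `x` to `x'`: the subspace `Ω` is the support of the hard
thresholding of order `q` of `Aᵀ (y - A x)`; `u` is the compressed Newton update; `w` solves the
relaxed optimal thresholding problem; `S` is the support of the hard thresholding of order `k` of
`w ⊗ u`; and `x'` solves the least-squares problem over the vectors supported in `S`. -/
def CNOTPStep {m n : ℕ} (A : Matrix (Fin m) (Fin n) ℝ) (y : EuclideanSpace ℝ (Fin m))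
    (k q : ℕ) (lam α γ : ℝ) (x x' : EuclideanSpace ℝ (Fin n)) : Prop :=
  ∃ (Ω : Finset (Fin n)) (u w : EuclideanSpace ℝ (Fin n)) (S : Finset (Fin n)),
    IsThresholdSupport q (mulE Aᵀ (y - mulE A x)) Ω ∧
    u = newtonUpdate A y lam α γ Ω x ∧
    IsArgmin (fun w => ‖y - mulE A (hadamard w u)‖ ^ 2) (weightSet n k) w ∧
    IsThresholdSupport k (hadamard w u) S ∧
    IsArgmin (fun z => ‖y - mulE A z‖ ^ 2) {z | supp z ⊆ S} x'

/-- `x` is a sequence generated by CNOTP, started at `0`. -/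
def IsCNOTPSequence {m n : ℕ} (A : Matrix (Fin m) (Fin n) ℝ) (y : EuclideanSpace ℝ (Fin m))
    (k q : ℕ) (lam α γ : ℝ) (x : ℕ → EuclideanSpace ℝ (Fin n)) : Prop :=
  x 0 = 0 ∧ ∀ p, CNOTPStep A y k q lam α γ (x p) (x (p + 1))

/-- `√⌈n / k⌉`. -/
def sqrtCeil (n k : ℕ) : ℝ := √(⌈(n : ℝ) / (k : ℝ)⌉₊ : ℝ)

/-- `Δ(λ, δ) = max {|1 - λ / (1 - δ)|, |1 - λ / (1 + δ)|}`. -/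
def stepDelta (lam δ : ℝ) : ℝ := max |1 - lam / (1 - δ)| |1 - lam / (1 + δ)|

/-- The contraction factor `ρ₄`. -/
def rho4 {m n : ℕ} (A : Matrix (Fin m) (Fin n) ℝ) (k q : ℕ) (lam : ℝ) : ℝ :=
  3 * Real.goldenRatio / (1 - ric A (2 * k)) *
    (ric A (3 * k) + stepDelta lam (ric A q) * (1 + sqrtCeil n k * ric A (3 * k)))

/-- The noise factor `τ₄`. -/
def tau4 {m n : ℕ} (A : Matrix (Fin m) (Fin n) ℝ) (k q : ℕ) (lam : ℝ) : ℝ :=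
  3 * lam * Real.goldenRatio * (1 + ric A k) * sqrtCeil n k /
      ((1 - ric A q) * (1 - ric A (2 * k)) * √(1 + ric A (2 * k))) +
    2 * Real.goldenRatio / ((1 - ric A (2 * k)) * √(1 + ric A (2 * k))) +
    √(1 + ric A k) / (1 - ric A (2 * k))

end

/-! Write `e = xS - x` for the current error; it is supported on at most `2k` indices. With `B =
M(Ω) Z(Ω)`, the error of the update `u` is `u - xS = (AᵀA - I) e + (λB - I) AᵀA e + λ B Aᵀη'`. On
any `k` indices the first term is at most `δ_{3k} ‖e‖`. `B` is symmetric with quadratic form between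
`1/(1+δ_q)` and `1/(1-δ_q)`, so `λB - I` has norm at most `Δ`. But `B` mixes coordinates, so the
full norm of `AᵀA e` is needed: covering the coordinates by `⌈n/k⌉` blocks of size `k` costs the
factor `c`. This is `norm_restrictTo_newtonUpdate_sub_le`.

Three further losses make up `ρ₄`. The relaxed weights cost `3` (`norm_restrictTo_sub_relaxed_le`):
`1` for the optimal residual, by comparison with a 0/1 weight, and `2` for the tail, by sorting the
weights into blocks of `k`. Hard thresholding costs the golden ratio (`norm_sub_restrictTo_top_le`).
Least squares costs `1/√(1-δ_{2k}²)` (`norm_sub_leastSquares_le`). `CNOTPStep.norm_sub_le`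
multiplies these together.

The window for `λ` says that `Δ` is below the value at which `ρ₄` equals `1`; convergence for `η' =
0` is then geometric. -/

/-! ### Linear algebra of restrictions and supports. -/

theorem mulE_eq_toEuclideanLin {m n : ℕ} (A : Matrix (Fin m) (Fin n) ℝ)
    (x : EuclideanSpace ℝ (Fin n)) : mulE A x = Matrix.toEuclideanLin A x := rfl

theorem mulE_add {m n : ℕ} (A : Matrix (Fin m) (Fin n) ℝ) (x z : EuclideanSpace ℝ (Fin n)) :
    mulE A (x + z) = mulE A x + mulE A z := by
  simp only [mulE_eq_toEuclideanLin, map_add]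

theorem mulE_sub {m n : ℕ} (A : Matrix (Fin m) (Fin n) ℝ) (x z : EuclideanSpace ℝ (Fin n)) :
    mulE A (x - z) = mulE A x - mulE A z := by
  simp only [mulE_eq_toEuclideanLin, map_sub]

theorem mulE_smul {m n : ℕ} (A : Matrix (Fin m) (Fin n) ℝ) (t : ℝ)
    (x : EuclideanSpace ℝ (Fin n)) : mulE A (t • x) = t • mulE A x := by
  simp only [mulE_eq_toEuclideanLin, map_smul]

theorem mulE_apply {m n : ℕ} (A : Matrix (Fin m) (Fin n) ℝ) (x : EuclideanSpace ℝ (Fin n))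
    (i : Fin m) : mulE A x i = ∑ j, A i j * x j := rfl

theorem euclidean_inner_eq_sum {n : ℕ} (x z : EuclideanSpace ℝ (Fin n)) :
    inner ℝ x z = ∑ i, x i * z i := by
  simp [PiLp.inner_apply, mul_comm]

theorem euclidean_norm_sq {n : ℕ} (x : EuclideanSpace ℝ (Fin n)) : ‖x‖ ^ 2 = ∑ i, x i ^ 2 := by
  simp [EuclideanSpace.norm_sq_eq]

theorem inner_mulE_transpose {m n : ℕ} (A : Matrix (Fin m) (Fin n) ℝ)
    (y : EuclideanSpace ℝ (Fin m)) (x : EuclideanSpace ℝ (Fin n)) :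
    inner ℝ (mulE Aᵀ y) x = inner ℝ y (mulE A x) := by
  simp only [euclidean_inner_eq_sum, mulE_apply, Finset.sum_mul, Finset.mul_sum,
    Matrix.transpose_apply]
  rw [Finset.sum_comm]
  exact Finset.sum_congr rfl fun i _ => Finset.sum_congr rfl fun j _ => by ring

theorem restrictTo_apply {n : ℕ} (S : Finset (Fin n)) (x : EuclideanSpace ℝ (Fin n))
    (i : Fin n) : restrictTo S x i = if i ∈ S then x i else 0 := rfl

theorem hadamard_apply {n : ℕ} (w u : EuclideanSpace ℝ (Fin n)) (i : Fin n) :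
    hadamard w u i = w i * u i := rfl

theorem restrictTo_add {n : ℕ} (S : Finset (Fin n)) (x z : EuclideanSpace ℝ (Fin n)) :
    restrictTo S (x + z) = restrictTo S x + restrictTo S z := by
  ext i
  by_cases h : i ∈ S <;> simp [restrictTo_apply, h]

theorem restrictTo_add_compl {n : ℕ} (S : Finset (Fin n)) (x : EuclideanSpace ℝ (Fin n)) :
    restrictTo S x + restrictTo Sᶜ x = x := by
  ext i
  by_cases h : i ∈ S <;> simp [restrictTo_apply, h]

theorem restrictTo_add_sdiff {n : ℕ} {T R : Finset (Fin n)} (hT : T ⊆ R)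
    (x : EuclideanSpace ℝ (Fin n)) :
    restrictTo R x = restrictTo T x + restrictTo (R \ T) x := by
  ext i
  by_cases h : i ∈ T
  · simp [restrictTo_apply, h, hT h]
  · by_cases h' : i ∈ R <;> simp [restrictTo_apply, h, h']

theorem norm_restrictTo_sq {n : ℕ} (S : Finset (Fin n)) (x : EuclideanSpace ℝ (Fin n)) :
    ‖restrictTo S x‖ ^ 2 = ∑ i ∈ S, x i ^ 2 := by
  simp [euclidean_norm_sq, restrictTo_apply, ite_pow, Finset.sum_ite_mem]

theorem norm_restrictTo_le {n : ℕ} (S : Finset (Fin n)) (x : EuclideanSpace ℝ (Fin n)) :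
    ‖restrictTo S x‖ ≤ ‖x‖ := by
  refine (abs_le_of_sq_le_sq' ?_ (norm_nonneg _)).2
  rw [norm_restrictTo_sq, euclidean_norm_sq]
  exact Finset.sum_le_sum_of_subset_of_nonneg (Finset.subset_univ _) fun i _ _ => sq_nonneg _

theorem norm_restrictTo_sq_eq_inner {n : ℕ} (S : Finset (Fin n)) (x : EuclideanSpace ℝ (Fin n)) :
    ‖restrictTo S x‖ ^ 2 = inner ℝ x (restrictTo S x) := by
  rw [norm_restrictTo_sq]
  simp [euclidean_inner_eq_sum, restrictTo_apply, sq]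

theorem mem_supp {n : ℕ} {x : EuclideanSpace ℝ (Fin n)} {i : Fin n} : i ∈ supp x ↔ x i ≠ 0 := by
  simp [supp]

theorem apply_eq_zero_of_supp_subset {n : ℕ} {x : EuclideanSpace ℝ (Fin n)} {S : Finset (Fin n)}
    (h : supp x ⊆ S) {i : Fin n} (hi : i ∉ S) : x i = 0 := by
  by_contra hx
  exact hi (h (mem_supp.2 hx))

theorem supp_restrictTo_subset {n : ℕ} (S : Finset (Fin n)) (x : EuclideanSpace ℝ (Fin n)) :
    supp (restrictTo S x) ⊆ S := by
  intro i hi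
  by_contra h
  exact mem_supp.1 hi (by simp [restrictTo_apply, h])

theorem restrictTo_eq_self {n : ℕ} {S : Finset (Fin n)} {x : EuclideanSpace ℝ (Fin n)}
    (h : supp x ⊆ S) : restrictTo S x = x := by
  ext i
  by_cases hi : i ∈ S
  · simp [restrictTo_apply, hi]
  · simp [restrictTo_apply, hi, apply_eq_zero_of_supp_subset h hi]

/-- The vectors supported in `S`. -/
def suppSubmodule {n : ℕ} (S : Finset (Fin n)) : Submodule ℝ (EuclideanSpace ℝ (Fin n)) where
  carrier := {x | supp x ⊆ S}
  zero_mem' i hi := absurd rfl (mem_supp.1 hi)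
  add_mem' {a b} ha hb i hi := by
    by_contra h
    refine mem_supp.1 hi ?_
    simp [apply_eq_zero_of_supp_subset ha h, apply_eq_zero_of_supp_subset hb h]
  smul_mem' t a ha i hi := by
    by_contra h
    refine mem_supp.1 hi ?_
    simp [apply_eq_zero_of_supp_subset ha h]

theorem mem_suppSubmodule {n : ℕ} {S : Finset (Fin n)} {x : EuclideanSpace ℝ (Fin n)} :
    x ∈ suppSubmodule S ↔ supp x ⊆ S := Iff.rfl

/-- A symmetric operator whose quadratic form is bounded by `C ‖v‖²` on a subspace has its
bilinear form bounded by `C ‖v‖ ‖w‖` there. -/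
theorem abs_inner_le_of_quadratic_bound {E : Type*} [NormedAddCommGroup E]
    [InnerProductSpace ℝ E] (L : E →ₗ[ℝ] E) (hL : L.IsSymmetric) (p : Submodule ℝ E) {C : ℝ}
    (hC : ∀ v ∈ p, |inner ℝ (L v) v| ≤ C * ‖v‖ ^ 2) {v w : E} (hv : v ∈ p) (hw : w ∈ p) :
    |inner ℝ (L v) w| ≤ C * (‖v‖ * ‖w‖) := by
  -- Polarization and the parallelogram law.
  have key : ∀ a ∈ p, ∀ b ∈ p, 4 * inner ℝ (L a) b ≤ C * (2 * (‖a‖ ^ 2 + ‖b‖ ^ 2)) := by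
    intro a ha b hb
    have h1 := (abs_le.1 (hC _ (p.add_mem ha hb))).2
    have h2 := (abs_le.1 (hC _ (p.sub_mem ha hb))).1
    have h3 := parallelogram_law_with_norm ℝ a b
    have h4 : inner ℝ (L b) a = inner ℝ (L a) b := by rw [hL b a, real_inner_comm]
    simp only [map_add, map_sub, inner_add_left, inner_add_right, inner_sub_left,
      inner_sub_right, h4] at h1 h2
    have h5 : 2 * (‖a‖ ^ 2 + ‖b‖ ^ 2) = ‖a + b‖ ^ 2 + ‖a - b‖ ^ 2 := by linarith
    rw [h5]
    linarith
  have upper : ∀ a ∈ p, ∀ b ∈ p, inner ℝ (L a) b ≤ C * (‖a‖ * ‖b‖) := by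
    intro a ha b hb
    rcases eq_or_ne a 0 with rfl | ha0
    · simp
    rcases eq_or_ne b 0 with rfl | hb0
    · simp
    -- Scaling each vector by the norm of the other equalizes the norms, which turns the sum of
    -- squares into the product.
    have h := key _ (p.smul_mem ‖b‖ ha) _ (p.smul_mem ‖a‖ hb)
    simp only [map_smul, real_inner_smul_left, real_inner_smul_right, norm_smul,
      norm_norm] at h
    have hpos : 0 < ‖a‖ * ‖b‖ := mul_pos (norm_pos_iff.2 ha0) (norm_pos_iff.2 hb0)
    refine le_of_mul_le_mul_left ?_ hpos
    nlinarith
  rw [abs_le]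
  constructor
  · have h := upper _ (p.neg_mem hv) _ hw
    simp only [map_neg, inner_neg_left, norm_neg] at h
    linarith
  · exact upper v hv w hw

/-! ### Restricted isometry constants -/

theorem ricSet_nonempty {m n : ℕ} (A : Matrix (Fin m) (Fin n) ℝ) (t : ℕ) :
    {δ : ℝ | 0 ≤ δ ∧ ∀ x : EuclideanSpace ℝ (Fin n), IsSparse t x →
    (1 - δ) * ‖x‖ ^ 2 ≤ ‖mulE A x‖ ^ 2 ∧ ‖mulE A x‖ ^ 2 ≤ (1 + δ) * ‖x‖ ^ 2}.Nonempty := by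
  let L := (Matrix.toEuclideanLin A).toContinuousLinearMap
  -- A constant at least `1` makes the lower bound trivial; the rest is the operator norm.
  refine ⟨1 + ‖L‖ ^ 2, by positivity, fun x _ => ⟨?_, ?_⟩⟩
  · nlinarith [sq_nonneg ‖mulE A x‖, mul_nonneg (sq_nonneg ‖L‖) (sq_nonneg ‖x‖)]
  · have h : ‖mulE A x‖ ≤ ‖L‖ * ‖x‖ := L.le_opNorm x
    have h2 := pow_le_pow_left₀ (norm_nonneg _) h 2
    nlinarith [sq_nonneg ‖x‖]

theorem ric_nonneg {m n : ℕ} (A : Matrix (Fin m) (Fin n) ℝ) (t : ℕ) : 0 ≤ ric A t :=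
  Real.sInf_nonneg fun _ h => h.1

theorem ric_mono {m n : ℕ} (A : Matrix (Fin m) (Fin n) ℝ) {s t : ℕ} (h : s ≤ t) :
    ric A s ≤ ric A t :=
  csInf_le_csInf ⟨0, fun _ h => h.1⟩ (ricSet_nonempty A t) fun _ hδ =>
    ⟨hδ.1, fun x hx => hδ.2 x (le_trans hx h)⟩

/-- The infimum is attained: the two bounds hold for constants arbitrarily close to it, and they are
closed conditions for each fixed vector. -/
theorem ric_bounds {m n : ℕ} (A : Matrix (Fin m) (Fin n) ℝ) {t : ℕ}
    {x : EuclideanSpace ℝ (Fin n)} (hx : IsSparse t x) :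
    (1 - ric A t) * ‖x‖ ^ 2 ≤ ‖mulE A x‖ ^ 2 ∧ ‖mulE A x‖ ^ 2 ≤ (1 + ric A t) * ‖x‖ ^ 2 := by
  have key : ∀ ε > 0, |‖mulE A x‖ ^ 2 - ‖x‖ ^ 2| ≤ (ric A t + ε) * ‖x‖ ^ 2 := by
    intro ε hε
    obtain ⟨δ, hδ, hlt⟩ := exists_lt_of_csInf_lt (ricSet_nonempty A t)
      (lt_add_of_pos_right (ric A t) hε)
    have h := hδ.2 x hx
    have h2 : δ * ‖x‖ ^ 2 ≤ (ric A t + ε) * ‖x‖ ^ 2 :=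
      mul_le_mul_of_nonneg_right hlt.le (sq_nonneg _)
    rw [abs_le]
    constructor <;> linarith [h.1, h.2]
  have h : |‖mulE A x‖ ^ 2 - ‖x‖ ^ 2| ≤ ric A t * ‖x‖ ^ 2 := by
    rcases eq_or_ne x 0 with rfl | h0
    · simpa using key 1 one_pos
    refine le_of_forall_pos_le_add fun ε hε => ?_
    have hp : 0 < ‖x‖ ^ 2 := pow_pos (norm_pos_iff.2 h0) 2
    have h := key (ε / ‖x‖ ^ 2) (div_pos hε hp)
    rwa [add_mul, div_mul_cancel₀ _ hp.ne'] at h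
  rw [abs_le] at h
  constructor <;> linarith [h.1, h.2]

theorem isSparse_of_supp_subset {n t : ℕ} {x : EuclideanSpace ℝ (Fin n)} {S : Finset (Fin n)}
    (h : supp x ⊆ S) (hS : S.card ≤ t) : IsSparse t x :=
  (Finset.card_le_card h).trans hS

theorem norm_mulE_le_of_sparse {m n : ℕ} (A : Matrix (Fin m) (Fin n) ℝ) {t : ℕ}
    {x : EuclideanSpace ℝ (Fin n)} (hx : IsSparse t x) :
    ‖mulE A x‖ ≤ √(1 + ric A t) * ‖x‖ := by
  have h0 : 0 ≤ 1 + ric A t := by linarith [ric_nonneg A t]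
  refine (abs_le_of_sq_le_sq' ?_ (by positivity)).2
  rw [mul_pow, Real.sq_sqrt h0]
  exact (ric_bounds A hx).2

theorem le_norm_mulE_of_sparse {m n : ℕ} (A : Matrix (Fin m) (Fin n) ℝ) {t : ℕ}
    (ht : ric A t ≤ 1) {x : EuclideanSpace ℝ (Fin n)} (hx : IsSparse t x) :
    √(1 - ric A t) * ‖x‖ ≤ ‖mulE A x‖ := by
  refine (abs_le_of_sq_le_sq' ?_ (norm_nonneg _)).2
  rw [mul_pow, Real.sq_sqrt (by linarith)]
  exact (ric_bounds A hx).1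

/-- The operator `AᵀA - I`. -/
noncomputable def gramDefect {m n : ℕ} (A : Matrix (Fin m) (Fin n) ℝ) :
    EuclideanSpace ℝ (Fin n) →ₗ[ℝ] EuclideanSpace ℝ (Fin n) :=
  Matrix.toEuclideanLin Aᵀ ∘ₗ Matrix.toEuclideanLin A - LinearMap.id

theorem gramDefect_apply {m n : ℕ} (A : Matrix (Fin m) (Fin n) ℝ)
    (x : EuclideanSpace ℝ (Fin n)) : gramDefect A x = mulE Aᵀ (mulE A x) - x := rfl

theorem inner_gramDefect {m n : ℕ} (A : Matrix (Fin m) (Fin n) ℝ)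
    (v w : EuclideanSpace ℝ (Fin n)) :
    inner ℝ (gramDefect A v) w = inner ℝ (mulE A v) (mulE A w) - inner ℝ v w := by
  rw [gramDefect_apply, inner_sub_left, inner_mulE_transpose]

theorem abs_inner_gramDefect_le {m n t : ℕ} (A : Matrix (Fin m) (Fin n) ℝ)
    {V : Finset (Fin n)} (hV : V.card ≤ t) {v w : EuclideanSpace ℝ (Fin n)}
    (hv : supp v ⊆ V) (hw : supp w ⊆ V) :
    |inner ℝ (gramDefect A v) w| ≤ ric A t * (‖v‖ * ‖w‖) := by
  refine abs_inner_le_of_quadratic_bound (gramDefect A) ?_ (suppSubmodule V) ?_ hv hw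
  · intro a b
    rw [real_inner_comm (gramDefect A b), inner_gramDefect, inner_gramDefect,
      real_inner_comm (mulE A a), real_inner_comm a]
  · intro a ha
    rw [inner_gramDefect, real_inner_self_eq_norm_sq, real_inner_self_eq_norm_sq, abs_le]
    have h := ric_bounds A (isSparse_of_supp_subset ha hV)
    constructor <;> linarith [h.1, h.2]

/-- Duality: the restriction is paired with itself, both vectors lying in `T ∪ V`, and one factor of
its norm is cancelled. -/
theorem norm_restrictTo_gramDefect_le {m n t : ℕ} (A : Matrix (Fin m) (Fin n) ℝ)
    {T V : Finset (Fin n)} (hV : (T ∪ V).card ≤ t) {v : EuclideanSpace ℝ (Fin n)}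
    (hv : supp v ⊆ V) : ‖restrictTo T (gramDefect A v)‖ ≤ ric A t * ‖v‖ := by
  set g := restrictTo T (gramDefect A v) with hg
  have h := (abs_le.1 (abs_inner_gramDefect_le A hV (hv.trans Finset.subset_union_right)
    ((supp_restrictTo_subset T (gramDefect A v)).trans Finset.subset_union_left))).2
  rw [← norm_restrictTo_sq_eq_inner, ← hg] at h
  rcases (norm_nonneg g).eq_or_lt with h0 | h0
  · rw [← h0]
    exact mul_nonneg (ric_nonneg A t) (norm_nonneg v)
  · refine le_of_mul_le_mul_right ?_ h0
    nlinarith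

theorem norm_restrictTo_transpose_le {m n t : ℕ} (A : Matrix (Fin m) (Fin n) ℝ)
    {T : Finset (Fin n)} (hT : T.card ≤ t) (η : EuclideanSpace ℝ (Fin m)) :
    ‖restrictTo T (mulE Aᵀ η)‖ ≤ √(1 + ric A t) * ‖η‖ := by
  set g := restrictTo T (mulE Aᵀ η) with hg
  have h : ‖g‖ ^ 2 ≤ ‖η‖ * (√(1 + ric A t) * ‖g‖) := by
    rw [hg, norm_restrictTo_sq_eq_inner, inner_mulE_transpose]
    refine (real_inner_le_norm _ _).trans (mul_le_mul_of_nonneg_left ?_ (norm_nonneg _))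
    exact norm_mulE_le_of_sparse A (isSparse_of_supp_subset (supp_restrictTo_subset _ _) hT)
  rcases (norm_nonneg g).eq_or_lt with h0 | h0
  · rw [← h0]
    positivity
  · refine le_of_mul_le_mul_right ?_ h0
    nlinarith

/-! ### Block decompositions -/

theorem norm_restrictTo_sq_le_of_blocks {n k : ℕ} (g : EuclideanSpace ℝ (Fin n)) {E : ℝ}
    (hE : ∀ T : Finset (Fin n), T.card ≤ k → ‖restrictTo T g‖ ≤ E) (N : ℕ) :
    ∀ R : Finset (Fin n), R.card ≤ N * k → ‖restrictTo R g‖ ^ 2 ≤ N * E ^ 2 := by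
  induction N with
  | zero =>
    intro R hR
    have : R = ∅ := by simpa using hR
    simp [this, norm_restrictTo_sq]
  | succ N ih =>
    intro R hR
    -- The minimum allows for a last block with fewer than `k` indices.
    obtain ⟨T, hTR, hT⟩ := Finset.exists_subset_card_eq (min_le_right k R.card)
    have h1 := pow_le_pow_left₀ (norm_nonneg _) (hE T (hT.le.trans (min_le_left _ _))) 2
    have h2 := ih (R \ T) (by
      rw [Finset.card_sdiff_of_subset hTR, hT]
      rw [Nat.succ_mul] at hR
      omega)
    have h3 : ‖restrictTo R g‖ ^ 2 = ‖restrictTo T g‖ ^ 2 + ‖restrictTo (R \ T) g‖ ^ 2 := by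
      simp only [norm_restrictTo_sq]
      rw [add_comm, Finset.sum_sdiff hTR]
    push_cast
    linarith

theorem norm_le_sqrtCeil_mul_of_blocks {n k : ℕ} (hk : 0 < k) (g : EuclideanSpace ℝ (Fin n))
    {E : ℝ} (hE : ∀ T : Finset (Fin n), T.card ≤ k → ‖restrictTo T g‖ ≤ E) :
    ‖g‖ ≤ sqrtCeil n k * E := by
  have hE0 : 0 ≤ E := (norm_nonneg _).trans (hE ∅ (by simp))
  have hcard : (Finset.univ : Finset (Fin n)).card ≤ ⌈(n : ℝ) / k⌉₊ * k := by
    rw [Finset.card_univ, Fintype.card_fin]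
    have hk' : (0 : ℝ) < k := by exact_mod_cast hk
    have h := (div_le_iff₀ hk').1 (Nat.le_ceil ((n : ℝ) / k))
    exact_mod_cast h
  have h := norm_restrictTo_sq_le_of_blocks g hE _ _ hcard
  rw [restrictTo_eq_self (Finset.subset_univ _)] at h
  refine (abs_le_of_sq_le_sq' ?_ (mul_nonneg (Real.sqrt_nonneg _) hE0)).2
  rwa [mul_pow, Real.sq_sqrt (Nat.cast_nonneg _)]

theorem exists_subset_card_eq_top {ι : Type*} [DecidableEq ι] (w : ι → ℝ) (R : Finset ι) :
    ∀ k ≤ R.card, ∃ T ⊆ R, T.card = k ∧ ∀ i ∈ T, ∀ j ∈ R \ T, w j ≤ w i := by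
  intro k
  induction k with
  | zero => exact fun _ => ⟨∅, by simp, by simp, by simp⟩
  | succ k ih =>
    intro hk
    obtain ⟨T, hTR, hT, htop⟩ := ih (by omega)
    have hne : (R \ T).Nonempty := by
      rw [← Finset.card_pos, Finset.card_sdiff_of_subset hTR]
      omega
    obtain ⟨a, ha, hmax⟩ := Finset.exists_max_image (R \ T) w hne
    have ha' := Finset.mem_sdiff.1 ha
    refine ⟨insert a T, Finset.insert_subset ha'.1 hTR, ?_, ?_⟩
    · rw [Finset.card_insert_of_notMem ha'.2, hT]
    · intro i hi j hj
      have hj' : j ∈ R \ T := by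
        simp only [Finset.mem_sdiff, Finset.mem_insert, not_or] at hj ⊢
        exact ⟨hj.1, hj.2.2⟩
      rcases Finset.mem_insert.1 hi with rfl | hi
      · exact hmax j hj'
      · exact htop i hi j hj'

theorem norm_restrictTo_hadamard_le {n : ℕ} {w d : EuclideanSpace ℝ (Fin n)}
    {T : Finset (Fin n)} {M : ℝ} (hM : 0 ≤ M) (hw0 : ∀ i, 0 ≤ w i) (hw : ∀ i ∈ T, w i ≤ M) :
    ‖restrictTo T (hadamard w d)‖ ≤ M * ‖restrictTo T d‖ := by
  refine (abs_le_of_sq_le_sq' ?_ (by positivity)).2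
  rw [mul_pow, norm_restrictTo_sq, norm_restrictTo_sq, Finset.mul_sum]
  refine Finset.sum_le_sum fun i hi => ?_
  rw [hadamard_apply, mul_pow]
  exact mul_le_mul_of_nonneg_right (pow_le_pow_left₀ (hw0 i) (hw i hi) 2) (sq_nonneg _)

/-- Peel off the `k` largest weights repeatedly. Each block contributes at most its largest weight,
which is at most the smallest, hence the average, of the preceding block; the averages sum to at
most `(∑ w)/k`, and `M` pays for the first block. `N` only drives the induction. -/
theorem norm_mulE_restrictTo_hadamard_le {m n k : ℕ} (hk : 0 < k) (A : Matrix (Fin m) (Fin n) ℝ)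
    {w d : EuclideanSpace ℝ (Fin n)} (hw0 : ∀ i, 0 ≤ w i) {E : ℝ}
    (hE : ∀ T : Finset (Fin n), T.card ≤ k → ‖restrictTo T d‖ ≤ E) :
    ∀ (N : ℕ) (R : Finset (Fin n)) (M : ℝ), R.card ≤ N → 0 ≤ M → (∀ i ∈ R, w i ≤ M) →
      ‖mulE A (restrictTo R (hadamard w d))‖ ≤
        √(1 + ric A k) * E * (M + (∑ i ∈ R, w i) / k) := by
  have hk' : (0 : ℝ) < k := by exact_mod_cast hk
  have hE0 : 0 ≤ E := (norm_nonneg _).trans (hE ∅ (by simp))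
  have hK : 0 ≤ √(1 + ric A k) := Real.sqrt_nonneg _
  have block : ∀ (T : Finset (Fin n)) (M : ℝ), T.card ≤ k → 0 ≤ M → (∀ i ∈ T, w i ≤ M) →
      ‖mulE A (restrictTo T (hadamard w d))‖ ≤ √(1 + ric A k) * E * M := by
    intro T M hT hM hw
    refine (norm_mulE_le_of_sparse A
      (isSparse_of_supp_subset (supp_restrictTo_subset _ _) hT)).trans ?_
    rw [mul_assoc]
    refine mul_le_mul_of_nonneg_left ?_ hK
    refine (norm_restrictTo_hadamard_le hM hw0 hw).trans ?_
    rw [mul_comm]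
    exact mul_le_mul_of_nonneg_right (hE T hT) hM
  intro N
  induction N with
  | zero =>
    intro R M hR hM hw
    refine (block R M (by omega) hM hw).trans (mul_le_mul_of_nonneg_left ?_ (by positivity))
    have : 0 ≤ (∑ i ∈ R, w i) / (k : ℝ) := div_nonneg (Finset.sum_nonneg fun i _ => hw0 i) hk'.le
    linarith
  | succ N ih =>
    intro R M hR hM hw
    by_cases hRk : R.card ≤ k
    · refine (block R M hRk hM hw).trans (mul_le_mul_of_nonneg_left ?_ (by positivity))
      have : 0 ≤ (∑ i ∈ R, w i) / (k : ℝ) :=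
        div_nonneg (Finset.sum_nonneg fun i _ => hw0 i) hk'.le
      linarith
    · obtain ⟨T, hTR, hT, htop⟩ := exists_subset_card_eq_top w R k (by omega)
      have hne : T.Nonempty := by rw [← Finset.card_pos]; omega
      obtain ⟨a, ha, hmin⟩ := Finset.exists_min_image T w hne
      have h1 := block T M hT.le hM fun i hi => hw i (hTR hi)
      have h2 := ih (R \ T) (w a) (by rw [Finset.card_sdiff_of_subset hTR]; omega) (hw0 a)
        fun j hj => htop a ha j hj
      have h3 : (k : ℝ) * w a ≤ ∑ i ∈ T, w i := by
        have := Finset.card_nsmul_le_sum T w (w a) hmin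
        rwa [hT, nsmul_eq_mul] at this
      have h4 : w a ≤ (∑ i ∈ T, w i) / k := by
        rw [le_div_iff₀ hk', mul_comm]
        exact h3
      rw [restrictTo_add_sdiff hTR, mulE_add, ← Finset.sum_sdiff hTR]
      calc _ ≤ √(1 + ric A k) * E * M +
            √(1 + ric A k) * E * (w a + (∑ i ∈ R \ T, w i) / k) :=
              (norm_add_le _ _).trans (add_le_add h1 h2)
        _ = √(1 + ric A k) * E * (M + (w a + (∑ i ∈ R \ T, w i) / k)) := by ring
        _ ≤ _ := by
          refine mul_le_mul_of_nonneg_left ?_ (by positivity)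
          rw [add_div]
          linarith

/-! ### Hard thresholding -/

/-- The gap is `(φ - 1)(φ(a - b) - b)²`. The weights `φ²` and `φ` fit because `1/φ² + 1/φ = 1`. -/
theorem sq_le_goldenRatio_combination (a b : ℝ) :
    a ^ 2 ≤ Real.goldenRatio ^ 2 * (a - b) ^ 2 + Real.goldenRatio * b ^ 2 := by
  have hφ2 := Real.goldenRatio_sq
  have hφ : 0 ≤ Real.goldenRatio - 1 := by linarith [Real.one_lt_goldenRatio]
  have h := mul_nonneg hφ (sq_nonneg (Real.goldenRatio * (a - b) - b))
  have h2 : (Real.goldenRatio - 1) * (Real.goldenRatio * (a - b) - b) ^ 2 =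
      Real.goldenRatio ^ 2 * (a - b) ^ 2 + Real.goldenRatio * b ^ 2 - a ^ 2 := by
    linear_combination ((Real.goldenRatio - 1) * (a - b) ^ 2 - 2 * (a - b) * b) * hφ2
  linarith

/-- `S \ T` has no more elements than `T \ S`, and each entry off `T` is dominated by every entry on
`T`. -/
theorem sum_sq_sdiff_le_of_top {n k : ℕ} {v : EuclideanSpace ℝ (Fin n)} {S T : Finset (Fin n)}
    (hS : S.card ≤ k) (hT : T.card = min k n) (htop : ∀ i ∈ T, ∀ j ∉ T, |v j| ≤ |v i|) :
    ∑ i ∈ S \ T, v i ^ 2 ≤ ∑ i ∈ T \ S, v i ^ 2 := by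
  rcases (S \ T).eq_empty_or_nonempty with h | hne
  · rw [h, Finset.sum_empty]
    exact Finset.sum_nonneg fun i _ => sq_nonneg _
  obtain ⟨a, ha, hmax⟩ := Finset.exists_max_image (S \ T) (fun i => v i ^ 2) hne
  have hSn : S.card ≤ n := by simpa using Finset.card_le_univ S
  have hcard : (S \ T).card ≤ (T \ S).card := by
    have h1 := Finset.card_sdiff_add_card_inter S T
    have h2 := Finset.card_sdiff_add_card_inter T S
    rw [Finset.inter_comm] at h2
    have h3 : S.card ≤ T.card := hT ▸ le_min hS hSn
    omega
  calc _ ≤ (S \ T).card • v a ^ 2 := Finset.sum_le_card_nsmul _ _ _ hmax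
    _ ≤ (T \ S).card • v a ^ 2 := nsmul_le_nsmul_left (sq_nonneg _) hcard
    _ ≤ _ := by
      refine Finset.card_nsmul_le_sum _ _ _ fun i hi => ?_
      exact sq_le_sq.2 (htop i (Finset.mem_sdiff.1 hi).1 a (Finset.mem_sdiff.1 ha).2)

/-- The entries of `x` lost on `S \ T` cost `φ²` times the error there plus `φ` times the mass of
`v` there. That mass is exchanged for mass on `T \ S`, where `x` vanishes and `v` is pure error. The
error on `T` then carries `1 + φ = φ²`, so both parts get the same constant. -/
theorem norm_sub_restrictTo_top_le {n k : ℕ} {x v : EuclideanSpace ℝ (Fin n)}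
    {S T : Finset (Fin n)} (hx : supp x ⊆ S)
    (hS : S.card ≤ k) (hT : T.card = min k n) (htop : ∀ i ∈ T, ∀ j ∉ T, |v j| ≤ |v i|) :
    ‖x - restrictTo T v‖ ≤ Real.goldenRatio * ‖restrictTo (S ∪ T) (x - v)‖ := by
  have hφ := Real.goldenRatio_pos
  have hφ2 := Real.goldenRatio_sq
  have h1 : ‖x - restrictTo T v‖ ^ 2 = ∑ i ∈ S \ T, x i ^ 2 + ∑ i ∈ T, (x i - v i) ^ 2 := by
    have : x - restrictTo T v = restrictTo (S ∪ T) (x - restrictTo T v) := by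
      refine (restrictTo_eq_self fun i hi => ?_).symm
      by_contra h
      rw [Finset.mem_union, not_or] at h
      refine mem_supp.1 hi ?_
      simp [restrictTo_apply, h.2, apply_eq_zero_of_supp_subset hx h.1]
    rw [this, norm_restrictTo_sq, ← Finset.sdiff_union_self_eq_union,
      Finset.sum_union Finset.sdiff_disjoint]
    congr 1
    · refine Finset.sum_congr rfl fun i hi => ?_
      simp [restrictTo_apply, (Finset.mem_sdiff.1 hi).2]
    · refine Finset.sum_congr rfl fun i hi => ?_
      simp [restrictTo_apply, hi]
  have h2 : ‖restrictTo (S ∪ T) (x - v)‖ ^ 2 =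
      ∑ i ∈ S \ T, (x i - v i) ^ 2 + ∑ i ∈ T, (x i - v i) ^ 2 := by
    rw [norm_restrictTo_sq, ← Finset.sdiff_union_self_eq_union,
      Finset.sum_union Finset.sdiff_disjoint]
    rfl
  have h3 : ∑ i ∈ T \ S, v i ^ 2 ≤ ∑ i ∈ T, (x i - v i) ^ 2 := by
    calc _ = ∑ i ∈ T \ S, (x i - v i) ^ 2 := Finset.sum_congr rfl fun i hi => by
          rw [apply_eq_zero_of_supp_subset hx (Finset.mem_sdiff.1 hi).2]; ring
      _ ≤ _ := Finset.sum_le_sum_of_subset_of_nonneg Finset.sdiff_subset fun i _ _ => sq_nonneg _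
  have h4 := sum_sq_sdiff_le_of_top hS hT htop
  have h5 : ∑ i ∈ S \ T, x i ^ 2 ≤ Real.goldenRatio ^ 2 * ∑ i ∈ S \ T, (x i - v i) ^ 2 +
      Real.goldenRatio * ∑ i ∈ S \ T, v i ^ 2 := by
    rw [Finset.mul_sum, Finset.mul_sum, ← Finset.sum_add_distrib]
    exact Finset.sum_le_sum fun i _ => sq_le_goldenRatio_combination _ _
  refine (abs_le_of_sq_le_sq' ?_ (by positivity)).2
  rw [mul_pow, h1, h2, mul_add]
  have h6 : Real.goldenRatio * ∑ i ∈ S \ T, v i ^ 2 ≤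
      Real.goldenRatio * ∑ i ∈ T, (x i - v i) ^ 2 :=
    mul_le_mul_of_nonneg_left (h4.trans h3) hφ.le
  have h7 : Real.goldenRatio ^ 2 * ∑ i ∈ T, (x i - v i) ^ 2 =
      Real.goldenRatio * ∑ i ∈ T, (x i - v i) ^ 2 + ∑ i ∈ T, (x i - v i) ^ 2 := by
    rw [hφ2]; ring
  linarith

/-! ### Least squares on a support -/

theorem inner_eq_zero_of_norm_le_sub_smul {F : Type*} [NormedAddCommGroup F]
    [InnerProductSpace ℝ F] {r g : F} (h : ∀ t : ℝ, ‖r‖ ^ 2 ≤ ‖r - t • g‖ ^ 2) :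
    inner ℝ r g = 0 := by
  rcases eq_or_ne g 0 with rfl | hg
  · simp
  have hp : 0 < ‖g‖ ^ 2 := pow_pos (norm_pos_iff.2 hg) 2
  -- This `t` minimizes the right-hand side.
  have h1 := h (inner ℝ r g / ‖g‖ ^ 2)
  rw [norm_sub_sq_real, real_inner_smul_right, norm_smul, mul_pow, Real.norm_eq_abs,
    sq_abs] at h1
  have h2 : (inner ℝ r g / ‖g‖ ^ 2) ^ 2 * ‖g‖ ^ 2 = inner ℝ r g ^ 2 / ‖g‖ ^ 2 := by
    field_simp
  have h3 : inner ℝ r g / ‖g‖ ^ 2 * inner ℝ r g = inner ℝ r g ^ 2 / ‖g‖ ^ 2 := by ring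
  rw [h2, h3] at h1
  have h4 : inner ℝ r g ^ 2 / ‖g‖ ^ 2 ≤ 0 := by linarith
  have h5 : inner ℝ r g ^ 2 ≤ 0 := by
    by_contra hc
    exact absurd h4 (not_le.2 (div_pos (not_le.1 hc) hp))
  exact pow_eq_zero_iff two_ne_zero |>.1 (le_antisymm h5 (sq_nonneg _))

/-- The hypothesis reads `((1-δ)N - s)((1+δ)N + s) ≤ D²`. With `X = N - s/(1-δ) ≥ 0` the left side
is at least `(1-δ²)X²`, so `X` cannot exceed `D/√(1-δ²)`. -/
theorem le_of_quadratic_bound {N s D δ : ℝ} (hs : 0 ≤ s) (hD : 0 ≤ D) (hδ0 : 0 ≤ δ) (hδ : δ < 1)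
    (h : N ^ 2 ≤ (δ * N + s) ^ 2 + D ^ 2) : N ≤ D / √(1 - δ ^ 2) + s / (1 - δ) := by
  have h1 : 0 < 1 - δ := by linarith
  have hr2 : 0 < 1 - δ ^ 2 := by nlinarith
  have hr := Real.sqrt_pos.2 hr2
  by_contra hc
  rw [not_le] at hc
  set X := N - s / (1 - δ) with hX
  have hsd : 0 ≤ s / (1 - δ) := div_nonneg hs h1.le
  have hXD : D / √(1 - δ ^ 2) < X := by linarith
  have hX0 : 0 ≤ X := (div_nonneg hD hr.le).trans hXD.le
  have h2 : D < X * √(1 - δ ^ 2) := (div_lt_iff₀ hr).1 hXD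
  have h3 := pow_lt_pow_left₀ h2 hD two_ne_zero
  rw [mul_pow, Real.sq_sqrt hr2.le] at h3
  have h4 : s / (1 - δ) * (1 - δ) = s := div_mul_cancel₀ _ h1.ne'
  have hN : N = X + s / (1 - δ) := by rw [hX]; ring
  have h5 : (1 - δ) * N - s = (1 - δ) * X := by rw [hN]; linarith
  have h6 : (1 - δ ^ 2) * N ^ 2 - 2 * δ * s * N - s ^ 2 =
      ((1 - δ) * X) * (N * (1 + δ) + s) := by rw [← h5]; ring
  have h7 : ((1 - δ) * X) * (X * (1 + δ)) ≤ ((1 - δ) * X) * (N * (1 + δ) + s) := by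
    refine mul_le_mul_of_nonneg_left ?_ (by positivity)
    have : X * (1 + δ) ≤ N * (1 + δ) := mul_le_mul_of_nonneg_right (by linarith) (by linarith)
    linarith
  nlinarith

/-- On `T`, orthogonality of the residual leaves only the Gram defect and the noise. Off `T`, both
`x'` and `z` vanish, so the error there is that of `z`. Combining the two gives a quadratic
inequality for the total error. -/
theorem norm_sub_leastSquares_le {m n k : ℕ} (A : Matrix (Fin m) (Fin n) ℝ)
    (hδ : ric A (2 * k) < 1) {xS x' z : EuclideanSpace ℝ (Fin n)} {η y : EuclideanSpace ℝ (Fin m)}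
    (hy : y = mulE A xS + η) {S T : Finset (Fin n)} (hS : S.card ≤ k) (hT : T.card ≤ k)
    (hxS : supp xS ⊆ S) (hz : supp z ⊆ T)
    (hx' : IsArgmin (fun z => ‖y - mulE A z‖ ^ 2) {z | supp z ⊆ T} x') :
    ‖xS - x'‖ ≤ ‖xS - z‖ / √(1 - ric A (2 * k) ^ 2) +
      √(1 + ric A k) * ‖η‖ / (1 - ric A (2 * k)) := by
  have hx'T : supp x' ⊆ T := hx'.1
  set d := xS - x' with hd
  have hres : y - mulE A x' = mulE A d + η := by rw [hy, hd, mulE_sub]; abel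
  have hopt : inner ℝ (mulE A d + η) (mulE A (restrictTo T d)) = 0 := by
    refine inner_eq_zero_of_norm_le_sub_smul fun t => ?_
    have hmem : x' + t • restrictTo T d ∈ suppSubmodule T :=
      (suppSubmodule T).add_mem hx'T ((suppSubmodule T).smul_mem t (supp_restrictTo_subset T d))
    have h := hx'.2 _ hmem
    have h2 : y - mulE A (x' + t • restrictTo T d) =
        mulE A d + η - t • mulE A (restrictTo T d) := by
      rw [mulE_add, mulE_smul, ← hres]; abel
    simp only [h2, hres] at h
    exact h
  have hTn : ‖restrictTo T d‖ ≤ ric A (2 * k) * ‖d‖ + √(1 + ric A k) * ‖η‖ := by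
    have hcard : (T ∪ S).card ≤ 2 * k := (Finset.card_union_le _ _).trans (by omega)
    have hdV : supp d ⊆ T ∪ S :=
      (suppSubmodule (T ∪ S)).sub_mem (mem_suppSubmodule.2 (hxS.trans Finset.subset_union_right))
        (mem_suppSubmodule.2 (hx'T.trans Finset.subset_union_left))
    have h1 := (abs_le.1 (abs_inner_gramDefect_le A hcard hdV
      ((supp_restrictTo_subset T d).trans Finset.subset_union_left))).1
    rw [inner_gramDefect, ← norm_restrictTo_sq_eq_inner] at h1
    rw [inner_add_left] at hopt
    have h2 := (abs_le.1 (abs_real_inner_le_norm η (mulE A (restrictTo T d)))).1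
    have h3 := mul_le_mul_of_nonneg_left (norm_mulE_le_of_sparse A
      (isSparse_of_supp_subset (supp_restrictTo_subset T d) hT)) (norm_nonneg η)
    rcases (norm_nonneg (restrictTo T d)).eq_or_lt with h0 | h0
    · rw [← h0]
      have := ric_nonneg A (2 * k)
      positivity
    · refine le_of_mul_le_mul_right ?_ h0
      nlinarith
  have hoff : ‖restrictTo Tᶜ d‖ ≤ ‖xS - z‖ := by
    have : restrictTo Tᶜ d = restrictTo Tᶜ (xS - z) := by
      ext i
      by_cases hi : i ∈ T
      · simp [restrictTo_apply, hi]
      · simp [restrictTo_apply, hi, hd, apply_eq_zero_of_supp_subset hx'T hi,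
          apply_eq_zero_of_supp_subset hz hi]
    rw [this]
    exact norm_restrictTo_le _ _
  have hsplit : ‖d‖ ^ 2 = ‖restrictTo T d‖ ^ 2 + ‖restrictTo Tᶜ d‖ ^ 2 := by
    rw [norm_restrictTo_sq, norm_restrictTo_sq, euclidean_norm_sq, Finset.sum_add_sum_compl]
  refine le_of_quadratic_bound (by positivity) (norm_nonneg _) (ric_nonneg _ _) hδ ?_
  rw [hsplit]
  exact add_le_add (pow_le_pow_left₀ (norm_nonneg _) hTn 2)
    (pow_le_pow_left₀ (norm_nonneg _) hoff 2)

/-! ### The compressed Newton operator -/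

/-- The operator `M(Ω) Z(Ω)`. -/
noncomputable def newtonOp {m n : ℕ} (A : Matrix (Fin m) (Fin n) ℝ) (α γ : ℝ)
    (Ω : Finset (Fin n)) : EuclideanSpace ℝ (Fin n) →ₗ[ℝ] EuclideanSpace ℝ (Fin n) :=
  Matrix.toEuclideanLin (newtonMatrix A α Ω) ∘ₗ Matrix.toEuclideanLin (scalingMatrix γ Ω)

theorem newtonOp_apply {m n : ℕ} (A : Matrix (Fin m) (Fin n) ℝ) (α γ : ℝ)
    (Ω : Finset (Fin n)) (g : EuclideanSpace ℝ (Fin n)) :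
    newtonOp A α γ Ω g = mulE (newtonMatrix A α Ω) (mulE (scalingMatrix γ Ω) g) := rfl

theorem mulE_scalingMatrix_apply {n : ℕ} (γ : ℝ) (Ω : Finset (Fin n))
    (g : EuclideanSpace ℝ (Fin n)) (i : Fin n) :
    mulE (scalingMatrix γ Ω) g i = (if i ∈ Ω then 1 else γ) * g i := by
  rw [mulE_apply, Finset.sum_eq_single i]
  · simp [scalingMatrix]
  · intro j _ hj
    simp [scalingMatrix, Matrix.diagonal_apply_ne' _ hj]
  · simp

theorem newtonOp_apply_of_notMem {m n : ℕ} (A : Matrix (Fin m) (Fin n) ℝ) (α γ : ℝ)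
    {Ω : Finset (Fin n)} (g : EuclideanSpace ℝ (Fin n)) {i : Fin n} (hi : i ∉ Ω) :
    newtonOp A α γ Ω g i = α * γ * g i := by
  rw [newtonOp_apply, mulE_apply, Finset.sum_eq_single i]
  · simp [newtonMatrix, mulE_scalingMatrix_apply, hi, mul_assoc]
  · intro j _ hj
    simp [newtonMatrix, hi, hj.symm]
  · simp

theorem newtonOp_apply_of_mem {m n : ℕ} (A : Matrix (Fin m) (Fin n) ℝ) (α γ : ℝ)
    {Ω : Finset (Fin n)} (g : EuclideanSpace ℝ (Fin n)) (i : Ω) :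
    newtonOp A α γ Ω g i =
      (((colSub A Ω)ᵀ * colSub A Ω)⁻¹ *ᵥ fun j : Ω => g j) i := by
  rw [newtonOp_apply, mulE_apply, Matrix.mulVec, dotProduct,
    ← Finset.sum_subset (Finset.subset_univ Ω), ← Finset.sum_coe_sort Ω]
  · refine Finset.sum_congr rfl fun j _ => ?_
    simp [newtonMatrix, mulE_scalingMatrix_apply]
  · intro j _ hj
    have hij : (i : Fin n) ≠ j := fun h => hj (h ▸ i.2)
    simp [newtonMatrix, hj, hij]

theorem mulE_restrictTo_apply {m n : ℕ} (A : Matrix (Fin m) (Fin n) ℝ) (Ω : Finset (Fin n))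
    (g : EuclideanSpace ℝ (Fin n)) (i : Fin m) :
    mulE A (restrictTo Ω g) i = (colSub A Ω *ᵥ fun j : Ω => g j) i := by
  rw [mulE_apply, Matrix.mulVec, dotProduct,
    ← Finset.sum_subset (Finset.subset_univ Ω), ← Finset.sum_coe_sort Ω]
  · refine Finset.sum_congr rfl fun j _ => ?_
    simp [colSub, restrictTo_apply]
  · intro j _ hj
    simp [restrictTo_apply, hj]

/-- A kernel vector of the Gram matrix is killed by `A_Ω`, and the lower isometry bound then forces
it to be zero. -/
theorem isUnit_gram_of_ric_lt_one {m n q : ℕ} (A : Matrix (Fin m) (Fin n) ℝ)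
    {Ω : Finset (Fin n)} (hΩ : Ω.card ≤ q) (hδ : ric A q < 1) :
    IsUnit ((colSub A Ω)ᵀ * colSub A Ω) := by
  rw [← Matrix.mulVec_injective_iff_isUnit]
  refine (injective_iff_map_eq_zero ((colSub A Ω)ᵀ * colSub A Ω).mulVecLin).2 fun z hz => ?_
  rw [Matrix.mulVecLin_apply] at hz
  set g : EuclideanSpace ℝ (Fin n) :=
    WithLp.toLp 2 fun i => if h : i ∈ Ω then z ⟨i, h⟩ else 0 with hg
  have hgz : (fun j : Ω => g j) = z := by
    ext j
    simp [hg]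
  have hAg : mulE A (restrictTo Ω g) = WithLp.toLp 2 (colSub A Ω *ᵥ z) := by
    ext i
    rw [mulE_restrictTo_apply, hgz]
  have hzero : colSub A Ω *ᵥ z = 0 := by
    rw [← Matrix.mulVec_mulVec] at hz
    have h : (colSub A Ω *ᵥ z) ⬝ᵥ (colSub A Ω *ᵥ z) = 0 := by
      rw [Matrix.dotProduct_mulVec, ← Matrix.mulVec_transpose, hz, zero_dotProduct]
    exact dotProduct_self_eq_zero.1 h
  have h := (ric_bounds A (isSparse_of_supp_subset (supp_restrictTo_subset Ω g) hΩ)).1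
  rw [hAg, hzero, WithLp.toLp_zero, norm_zero] at h
  have h0 : ‖restrictTo Ω g‖ ^ 2 = 0 := by
    refine le_antisymm ?_ (sq_nonneg _)
    by_contra hc
    have := mul_pos (sub_pos.2 hδ) (not_le.1 hc)
    linarith
  have h1 : restrictTo Ω g = 0 := norm_eq_zero.1 (pow_eq_zero_iff two_ne_zero |>.1 h0)
  ext j
  have h2 : restrictTo Ω g j = 0 := by rw [h1]; rfl
  rw [← hgz]
  simpa [restrictTo_apply] using h2

theorem gram_newtonOp_apply {m n q : ℕ} (A : Matrix (Fin m) (Fin n) ℝ) (α γ : ℝ)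
    {Ω : Finset (Fin n)} (hΩ : Ω.card ≤ q) (hδ : ric A q < 1) (g : EuclideanSpace ℝ (Fin n))
    {i : Fin n} (hi : i ∈ Ω) :
    mulE Aᵀ (mulE A (restrictTo Ω (newtonOp A α γ Ω g))) i = g i := by
  have hu := isUnit_gram_of_ric_lt_one A hΩ hδ
  have h1 : (fun j : Ω => newtonOp A α γ Ω g j) =
      ((colSub A Ω)ᵀ * colSub A Ω)⁻¹ *ᵥ fun j : Ω => g j :=
    funext fun j => newtonOp_apply_of_mem A α γ g j
  have h2 : mulE A (restrictTo Ω (newtonOp A α γ Ω g)) =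
      WithLp.toLp 2 (colSub A Ω *ᵥ (((colSub A Ω)ᵀ * colSub A Ω)⁻¹ *ᵥ fun j : Ω => g j)) := by
    ext l
    rw [mulE_restrictTo_apply, h1]
  have h3 : mulE Aᵀ (mulE A (restrictTo Ω (newtonOp A α γ Ω g))) i =
      ((colSub A Ω)ᵀ *ᵥ (colSub A Ω *ᵥ
        (((colSub A Ω)ᵀ * colSub A Ω)⁻¹ *ᵥ fun j : Ω => g j))) ⟨i, hi⟩ := by
    rw [h2]
    rfl
  rw [h3, Matrix.mulVec_mulVec, Matrix.mulVec_mulVec,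
    Matrix.mul_nonsing_inv _ ((Matrix.isUnit_iff_isUnit_det _).1 hu), Matrix.one_mulVec]

/-- Since the `Ω` block inverts the Gram matrix, `h` on `Ω` can be replaced by `AᵀA (Bh)_Ω`. The
resulting form is visibly symmetric. -/
theorem inner_newtonOp {m n q : ℕ} (A : Matrix (Fin m) (Fin n) ℝ) (α γ : ℝ)
    {Ω : Finset (Fin n)} (hΩ : Ω.card ≤ q) (hδ : ric A q < 1)
    (g h : EuclideanSpace ℝ (Fin n)) :
    inner ℝ (newtonOp A α γ Ω g) h =
      inner ℝ (mulE A (restrictTo Ω (newtonOp A α γ Ω g)))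
        (mulE A (restrictTo Ω (newtonOp A α γ Ω h))) +
      α * γ * inner ℝ (restrictTo Ωᶜ g) (restrictTo Ωᶜ h) := by
  rw [real_inner_comm, real_inner_comm (mulE A (restrictTo Ω (newtonOp A α γ Ω h))),
    ← inner_mulE_transpose]
  simp only [euclidean_inner_eq_sum, Finset.mul_sum, ← Finset.sum_add_distrib]
  refine Finset.sum_congr rfl fun i _ => ?_
  by_cases hi : i ∈ Ω
  · rw [gram_newtonOp_apply A α γ hΩ hδ h hi]
    simp [restrictTo_apply, hi]
  · rw [newtonOp_apply_of_notMem A α γ g hi]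
    simp only [restrictTo_apply, hi, Finset.mem_compl, not_false_eq_true, if_true, if_false]
    ring

theorem newtonOp_isSymmetric {m n q : ℕ} (A : Matrix (Fin m) (Fin n) ℝ) (α γ : ℝ)
    {Ω : Finset (Fin n)} (hΩ : Ω.card ≤ q) (hδ : ric A q < 1) :
    (newtonOp A α γ Ω).IsSymmetric := by
  intro g h
  rw [real_inner_comm (newtonOp A α γ Ω h), inner_newtonOp A α γ hΩ hδ, inner_newtonOp A α γ hΩ hδ,
    real_inner_comm (restrictTo Ωᶜ g), real_inner_comm (mulE A (restrictTo Ω (newtonOp A α γ Ω g)))]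

/-- No diagonalization is needed: with `w = (Bg)_Ω` one has `⟨Aw, Av⟩ = ⟨g_Ω, v⟩` for `v` supported
in `Ω`. Cauchy–Schwarz with `v = g_Ω` gives the lower bound on `‖Aw‖²`, with `v = w` the upper one.
Off `Ω` the form is `αγ` times the squared norm, and `αγ` is assumed to lie in the same interval. -/
theorem inner_newtonOp_self_bounds {m n q : ℕ} (A : Matrix (Fin m) (Fin n) ℝ) {α γ : ℝ}
    {Ω : Finset (Fin n)} (hΩ : Ω.card ≤ q) (hδ : ric A q < 1)
    (hlower : 1 / (1 + ric A q) ≤ α * γ) (hupper : α * γ ≤ 1 / (1 - ric A q))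
    (g : EuclideanSpace ℝ (Fin n)) :
    1 / (1 + ric A q) * ‖g‖ ^ 2 ≤ inner ℝ (newtonOp A α γ Ω g) g ∧
      inner ℝ (newtonOp A α γ Ω g) g ≤ 1 / (1 - ric A q) * ‖g‖ ^ 2 := by
  have hp : 0 < 1 + ric A q := by linarith [ric_nonneg A q]
  have hm : 0 < 1 - ric A q := by linarith
  set w := restrictTo Ω (newtonOp A α γ Ω g) with hw
  have hwsparse : IsSparse q w := isSparse_of_supp_subset (supp_restrictTo_subset _ _) hΩ
  have hgsparse : IsSparse q (restrictTo Ω g) :=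
    isSparse_of_supp_subset (supp_restrictTo_subset _ _) hΩ
  have hG : restrictTo Ω (mulE Aᵀ (mulE A w)) = restrictTo Ω g := by
    ext i
    by_cases hi : i ∈ Ω
    · simp only [restrictTo_apply, hi, if_true]
      exact gram_newtonOp_apply A α γ hΩ hδ g hi
    · simp [restrictTo_apply, hi]
  have hsplit : ‖g‖ ^ 2 = ‖restrictTo Ω g‖ ^ 2 + ‖restrictTo Ωᶜ g‖ ^ 2 := by
    rw [norm_restrictTo_sq, norm_restrictTo_sq, euclidean_norm_sq, Finset.sum_add_sum_compl]
  have hform : inner ℝ (newtonOp A α γ Ω g) g =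
      ‖mulE A w‖ ^ 2 + α * γ * ‖restrictTo Ωᶜ g‖ ^ 2 := by
    rw [inner_newtonOp A α γ hΩ hδ, real_inner_self_eq_norm_sq, real_inner_self_eq_norm_sq]
  have hinner : ∀ v : EuclideanSpace ℝ (Fin n), supp v ⊆ Ω →
      inner ℝ (mulE A w) (mulE A v) = inner ℝ (restrictTo Ω g) v := by
    intro v hv
    rw [← inner_mulE_transpose, ← hG]
    simp only [euclidean_inner_eq_sum, restrictTo_apply]
    refine Finset.sum_congr rfl fun i _ => ?_
    by_cases hi : i ∈ Ω
    · simp [hi]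
    · simp [hi, apply_eq_zero_of_supp_subset hv hi]
  have hlow : 1 / (1 + ric A q) * ‖restrictTo Ω g‖ ^ 2 ≤ ‖mulE A w‖ ^ 2 := by
    have h1 := hinner _ (supp_restrictTo_subset Ω g)
    rw [real_inner_self_eq_norm_sq] at h1
    have h2 := real_inner_le_norm (mulE A w) (mulE A (restrictTo Ω g))
    have h3 := (ric_bounds A hgsparse).2
    rw [h1] at h2
    have h4 := pow_le_pow_left₀ (sq_nonneg _) h2 2
    rw [mul_pow] at h4
    have h5 := h4.trans (mul_le_mul_of_nonneg_left h3 (sq_nonneg ‖mulE A w‖))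
    rw [one_div_mul_eq_div, div_le_iff₀ hp]
    rcases (sq_nonneg ‖restrictTo Ω g‖).eq_or_lt with h0 | h0
    · rw [← h0]; positivity
    · refine le_of_mul_le_mul_right ?_ h0
      nlinarith
  have hupp : ‖mulE A w‖ ^ 2 ≤ 1 / (1 - ric A q) * ‖restrictTo Ω g‖ ^ 2 := by
    have h1 := hinner w (supp_restrictTo_subset Ω _)
    rw [real_inner_self_eq_norm_sq] at h1
    have h2 := real_inner_le_norm (restrictTo Ω g) w
    rw [← h1] at h2
    have h3 := (ric_bounds A hwsparse).1
    have h4 := pow_le_pow_left₀ (sq_nonneg _) h2 2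
    rw [mul_pow] at h4
    rw [one_div_mul_eq_div, le_div_iff₀ hm]
    rcases (sq_nonneg ‖mulE A w‖).eq_or_lt with h0 | h0
    · rw [← h0]; simp
    · refine le_of_mul_le_mul_right ?_ h0
      have h5 := mul_le_mul_of_nonneg_left h3 (sq_nonneg ‖restrictTo Ω g‖)
      have h6 := mul_le_mul_of_nonneg_left h4 hm.le
      nlinarith
  have hc := sq_nonneg ‖restrictTo Ωᶜ g‖
  have h1 := mul_le_mul_of_nonneg_right hlower hc
  have h2 := mul_le_mul_of_nonneg_right hupper hc
  rw [hform, hsplit, mul_add, mul_add]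
  constructor <;> linarith

theorem norm_le_of_quadratic_bound {E : Type*} [NormedAddCommGroup E]
    [InnerProductSpace ℝ E] (L : E →ₗ[ℝ] E) (hL : L.IsSymmetric) {C : ℝ} (hC0 : 0 ≤ C)
    (hC : ∀ v, |inner ℝ (L v) v| ≤ C * ‖v‖ ^ 2) (v : E) : ‖L v‖ ≤ C * ‖v‖ := by
  have h := (abs_le.1 (abs_inner_le_of_quadratic_bound L hL ⊤ (fun v _ => hC v)
    (Submodule.mem_top (x := v)) (Submodule.mem_top (x := L v)))).2
  rw [real_inner_self_eq_norm_sq] at h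
  rcases (norm_nonneg (L v)).eq_or_lt with h0 | h0
  · rw [← h0]; positivity
  · refine le_of_mul_le_mul_right ?_ h0
    nlinarith

theorem norm_newtonOp_le {m n q : ℕ} (A : Matrix (Fin m) (Fin n) ℝ) {α γ : ℝ}
    {Ω : Finset (Fin n)} (hΩ : Ω.card ≤ q) (hδ : ric A q < 1)
    (hlower : 1 / (1 + ric A q) ≤ α * γ) (hupper : α * γ ≤ 1 / (1 - ric A q))
    (g : EuclideanSpace ℝ (Fin n)) :
    ‖newtonOp A α γ Ω g‖ ≤ 1 / (1 - ric A q) * ‖g‖ := by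
  have hp : 0 < 1 + ric A q := by linarith [ric_nonneg A q]
  have hm : 0 < 1 - ric A q := by linarith
  refine norm_le_of_quadratic_bound _ (newtonOp_isSymmetric A α γ hΩ hδ) (by positivity)
    (fun v => ?_) g
  have h := inner_newtonOp_self_bounds A hΩ hδ hlower hupper v
  have h1 : 0 ≤ 1 / (1 + ric A q) * ‖v‖ ^ 2 := by positivity
  rw [abs_of_nonneg (h1.trans h.1)]
  exact h.2

theorem stepDelta_nonneg (lam δ : ℝ) : 0 ≤ stepDelta lam δ :=
  (abs_nonneg _).trans (le_max_left _ _)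

theorem norm_smul_newtonOp_sub_le {m n q : ℕ} (A : Matrix (Fin m) (Fin n) ℝ) {α γ lam : ℝ}
    (hlam : 0 ≤ lam) {Ω : Finset (Fin n)} (hΩ : Ω.card ≤ q) (hδ : ric A q < 1)
    (hlower : 1 / (1 + ric A q) ≤ α * γ) (hupper : α * γ ≤ 1 / (1 - ric A q))
    (g : EuclideanSpace ℝ (Fin n)) :
    ‖lam • newtonOp A α γ Ω g - g‖ ≤ stepDelta lam (ric A q) * ‖g‖ := by
  have hsym : (lam • newtonOp A α γ Ω - LinearMap.id).IsSymmetric := by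
    intro a b
    simp only [LinearMap.sub_apply, LinearMap.smul_apply, LinearMap.id_apply, inner_sub_left,
      inner_sub_right, real_inner_smul_left, real_inner_smul_right,
      newtonOp_isSymmetric A α γ hΩ hδ a b]
  refine norm_le_of_quadratic_bound (lam • newtonOp A α γ Ω - LinearMap.id) hsym
    (stepDelta_nonneg _ _) (fun v => ?_) g
  have h := inner_newtonOp_self_bounds A hΩ hδ hlower hupper v
  have hv := sq_nonneg ‖v‖
  have h1 := mul_le_mul_of_nonneg_left h.1 hlam
  have h2 := mul_le_mul_of_nonneg_left h.2 hlam
  have h3 : lam / (1 - ric A q) - 1 ≤ stepDelta lam (ric A q) :=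
    (neg_sub (1 : ℝ) (lam / (1 - ric A q)) ▸ neg_le_abs _).trans (le_max_left _ _)
  have h4 : 1 - lam / (1 + ric A q) ≤ stepDelta lam (ric A q) :=
    (le_abs_self _).trans (le_max_right _ _)
  have h5 := mul_le_mul_of_nonneg_right h3 hv
  have h6 := mul_le_mul_of_nonneg_right h4 hv
  simp only [LinearMap.sub_apply, LinearMap.smul_apply, LinearMap.id_apply, inner_sub_left,
    real_inner_smul_left, real_inner_self_eq_norm_sq]
  rw [abs_le]
  rw [← mul_assoc, mul_one_div] at h1 h2
  constructor <;> linarith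

/-! ### One iteration -/

theorem norm_restrictTo_newtonUpdate_sub_le {m n k q : ℕ} (hk : 0 < k)
    (A : Matrix (Fin m) (Fin n) ℝ) {lam α γ : ℝ} (hlam : 0 ≤ lam) {Ω : Finset (Fin n)}
    (hΩ : Ω.card ≤ q) (hδ : ric A q < 1)
    (hlower : 1 / (1 + ric A q) ≤ α * γ) (hupper : α * γ ≤ 1 / (1 - ric A q))
    {xS x : EuclideanSpace ℝ (Fin n)} {η y : EuclideanSpace ℝ (Fin m)} (hy : y = mulE A xS + η)
    {V : Finset (Fin n)} (hV : V.card ≤ 2 * k) (hxV : supp (xS - x) ⊆ V)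
    {T : Finset (Fin n)} (hT : T.card ≤ k) :
    ‖restrictTo T (newtonUpdate A y lam α γ Ω x - xS)‖ ≤
      (ric A (3 * k) + stepDelta lam (ric A q) * (1 + sqrtCeil n k * ric A (3 * k))) * ‖x - xS‖ +
        lam * (1 / (1 - ric A q)) * (sqrtCeil n k * (√(1 + ric A k) * ‖η‖)) := by
  have hm : 0 < 1 - ric A q := by linarith
  have hΔ := stepDelta_nonneg lam (ric A q)
  set e := xS - x with he
  have hne : ‖x - xS‖ = ‖e‖ := norm_sub_rev _ _
  set B := newtonOp A α γ Ω with hB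
  set g := mulE Aᵀ (mulE A e) with hg
  have hres : y - mulE A x = mulE A e + η := by rw [hy, he, mulE_sub]; abel
  have hdec : newtonUpdate A y lam α γ Ω x - xS =
      gramDefect A e + ((lam • B g - g) + lam • B (mulE Aᵀ η)) := by
    have h1 : newtonUpdate A y lam α γ Ω x = x + lam • B (mulE Aᵀ (y - mulE A x)) := rfl
    rw [h1, hres, mulE_add, map_add, smul_add, gramDefect_apply, ← hg, he]
    abel
  have hblock : ∀ T : Finset (Fin n), T.card ≤ k →
      ‖restrictTo T (gramDefect A e)‖ ≤ ric A (3 * k) * ‖e‖ := fun T hT =>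
    norm_restrictTo_gramDefect_le A ((Finset.card_union_le T V).trans (by omega)) hxV
  have hgn : ‖g‖ ≤ (1 + sqrtCeil n k * ric A (3 * k)) * ‖e‖ := by
    have h1 : g = e + gramDefect A e := by rw [gramDefect_apply, ← hg]; abel
    have h2 := norm_le_sqrtCeil_mul_of_blocks hk (gramDefect A e) hblock
    rw [h1]
    refine (norm_add_le _ _).trans ?_
    linarith
  have hηn := norm_le_sqrtCeil_mul_of_blocks hk (mulE Aᵀ η) fun T hT =>
    norm_restrictTo_transpose_le A hT η
  have h1 := hblock T hT
  have h2 := (norm_restrictTo_le T (lam • B g - g)).trans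
    ((norm_smul_newtonOp_sub_le A hlam hΩ hδ hlower hupper g).trans
      (mul_le_mul_of_nonneg_left hgn hΔ))
  have h3 : ‖restrictTo T (lam • B (mulE Aᵀ η))‖ ≤
      lam * (1 / (1 - ric A q)) * (sqrtCeil n k * (√(1 + ric A k) * ‖η‖)) := by
    refine (norm_restrictTo_le _ _).trans ?_
    rw [norm_smul, Real.norm_of_nonneg hlam, mul_assoc]
    refine mul_le_mul_of_nonneg_left ?_ hlam
    exact (norm_newtonOp_le A hΩ hδ hlower hupper _).trans
      (mul_le_mul_of_nonneg_left hηn (by positivity))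
  rw [hdec, restrictTo_add, restrictTo_add, hne]
  have h4 := norm_add_le (restrictTo T (gramDefect A e))
    (restrictTo T (lam • B g - g) + restrictTo T (lam • B (mulE Aᵀ η)))
  have h5 := norm_add_le (restrictTo T (lam • B g - g)) (restrictTo T (lam • B (mulE Aᵀ η)))
  linarith

theorem norm_restrictTo_sub_relaxed_le {m n k : ℕ} (hk : 0 < k)
    (A : Matrix (Fin m) (Fin n) ℝ) (hδ : ric A (2 * k) ≤ 1)
    {xS u w : EuclideanSpace ℝ (Fin n)} {η y : EuclideanSpace ℝ (Fin m)}
    (hy : y = mulE A xS + η) {S V : Finset (Fin n)} (hS : S.card ≤ k) (hxS : supp xS ⊆ S)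
    (hSV : S ⊆ V) (hV : V.card ≤ 2 * k)
    (hw : IsArgmin (fun w => ‖y - mulE A (hadamard w u)‖ ^ 2) (weightSet n k) w) {E : ℝ}
    (hE : ∀ T : Finset (Fin n), T.card ≤ k → ‖restrictTo T (u - xS)‖ ≤ E) :
    √(1 - ric A (2 * k)) * ‖restrictTo V (xS - hadamard w u)‖ ≤
      3 * √(1 + ric A k) * E + 2 * ‖η‖ := by
  have hk' : (0 : ℝ) < k := by exact_mod_cast hk
  obtain ⟨⟨hsum, hbd⟩, hmin⟩ := hw
  have hE0 : 0 ≤ E := (norm_nonneg _).trans (hE ∅ (by simp))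
  have hkn : k ≤ n := by
    have h : ∑ i, w i ≤ ∑ _i : Fin n, (1 : ℝ) := Finset.sum_le_sum fun i _ => (hbd i).2
    rw [hsum] at h
    simpa using h
  -- `S` may have fewer than `k` elements, while feasible weights sum to exactly `k`.
  obtain ⟨T, hST, hT⟩ := Finset.exists_superset_card_eq hS (by simpa using hkn)
  have hfeas : (WithLp.toLp 2 fun i => if i ∈ T then (1 : ℝ) else 0) ∈ weightSet n k := by
    constructor
    · simp [hT]
    · intro i
      by_cases hi : i ∈ T <;> simp [hi]
  have hopt : ‖y - mulE A (hadamard w u)‖ ≤ √(1 + ric A k) * E + ‖η‖ := by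
    have h1 := (abs_le_of_sq_le_sq' (hmin _ hfeas) (norm_nonneg _)).2
    have h2 : hadamard (WithLp.toLp 2 fun i => if i ∈ T then (1 : ℝ) else 0) u =
        xS + restrictTo T (u - xS) := by
      ext i
      by_cases hi : i ∈ T
      · simp [hadamard_apply, restrictTo_apply, hi]
      · simp [hadamard_apply, restrictTo_apply, hi,
          apply_eq_zero_of_supp_subset (hxS.trans hST) hi]
    rw [h2, hy, mulE_add, add_sub_add_left_eq_sub] at h1
    rw [hy]
    have h3 := norm_mulE_le_of_sparse A
      (isSparse_of_supp_subset (supp_restrictTo_subset T (u - xS)) hT.le)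
    have h4 := mul_le_mul_of_nonneg_left (hE T hT.le) (Real.sqrt_nonneg (1 + ric A k))
    have h5 := norm_sub_le η (mulE A (restrictTo T (u - xS)))
    linarith
  have htail : ‖mulE A (restrictTo Vᶜ (hadamard w (u - xS)))‖ ≤ 2 * √(1 + ric A k) * E := by
    have h1 := norm_mulE_restrictTo_hadamard_le hk A (fun i => (hbd i).1) hE _ Vᶜ 1 le_rfl
      zero_le_one fun i _ => (hbd i).2
    have h2 : (∑ i ∈ Vᶜ, w i) / (k : ℝ) ≤ 1 := by
      rw [div_le_one hk', ← hsum]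
      exact Finset.sum_le_sum_of_subset_of_nonneg (Finset.subset_univ _) fun i _ _ => (hbd i).1
    have h3 := mul_le_mul_of_nonneg_left h2 (mul_nonneg (Real.sqrt_nonneg (1 + ric A k)) hE0)
    linarith
  have hdec : mulE A (restrictTo V (xS - hadamard w u)) =
      (y - mulE A (hadamard w u)) + mulE A (restrictTo Vᶜ (hadamard w (u - xS))) - η := by
    -- Off `V` the vector `xS` vanishes, so `w ⊗ u` equals `w ⊗ (u - xS)` there and the blockwise
    -- error bound applies.
    have h1 : xS - hadamard w u =
        restrictTo V (xS - hadamard w u) - restrictTo Vᶜ (hadamard w (u - xS)) := by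
      ext i
      by_cases hi : i ∈ V
      · simp [restrictTo_apply, hi]
      · simp [restrictTo_apply, hadamard_apply, hi,
          apply_eq_zero_of_supp_subset (hxS.trans hSV) hi]
    have h2 := congrArg (mulE A) h1
    rw [mulE_sub, mulE_sub A (restrictTo V _)] at h2
    rw [hy, ← sub_eq_zero]
    rw [← sub_eq_zero] at h2
    rw [← neg_eq_zero, ← h2]
    abel
  refine (le_norm_mulE_of_sparse A hδ
    (isSparse_of_supp_subset (supp_restrictTo_subset V _) hV)).trans ?_
  rw [hdec]
  have h1 := norm_sub_le ((y - mulE A (hadamard w u)) +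
    mulE A (restrictTo Vᶜ (hadamard w (u - xS)))) η
  have h2 := norm_add_le (y - mulE A (hadamard w u))
    (mulE A (restrictTo Vᶜ (hadamard w (u - xS))))
  linarith

theorem IsThresholdSupport.card_le {n t : ℕ} {z : EuclideanSpace ℝ (Fin n)}
    {S : Finset (Fin n)} (h : IsThresholdSupport t z S) : S.card ≤ t := by
  obtain ⟨_, ⟨T, hT, -, rfl⟩, rfl⟩ := h
  exact (Finset.card_le_card (supp_restrictTo_subset T z)).trans (hT.le.trans (min_le_left _ _))

theorem CNOTPStep.exists_supp_subset {m n k q : ℕ} {A : Matrix (Fin m) (Fin n) ℝ}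
    {y : EuclideanSpace ℝ (Fin m)} {lam α γ : ℝ} {x x' : EuclideanSpace ℝ (Fin n)}
    (h : CNOTPStep A y k q lam α γ x x') : ∃ S : Finset (Fin n), S.card ≤ k ∧ supp x' ⊆ S := by
  obtain ⟨_, _, _, S, -, -, -, hS, hx'⟩ := h
  exact ⟨S, hS.card_le, hx'.1⟩

theorem CNOTPStep.norm_sub_le {m n k q : ℕ} (hk : 0 < k) {A : Matrix (Fin m) (Fin n) ℝ}
    {xS x x' : EuclideanSpace ℝ (Fin n)} {η y : EuclideanSpace ℝ (Fin m)} {lam α γ : ℝ}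
    (hlam : 0 ≤ lam) (hδq : ric A q < 1) (hδ : ric A (2 * k) < 1)
    (hlower : 1 / (1 + ric A q) ≤ α * γ) (hupper : α * γ ≤ 1 / (1 - ric A q))
    (hy : y = mulE A xS + η) {S S₀ : Finset (Fin n)} (hS : S.card ≤ k) (hxS : supp xS ⊆ S)
    (hS₀ : S₀.card ≤ k) (hx : supp x ⊆ S₀) (h : CNOTPStep A y k q lam α γ x x') :
    ‖x' - xS‖ ≤ rho4 A k q lam * ‖x - xS‖ + tau4 A k q lam * ‖η‖ := by
  obtain ⟨Ω, u, w, S', hΩ, hu, hw, hS', hx'⟩ := h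
  have hS'card := hS'.card_le
  -- `T` is the set of selected indices; `S'` may be smaller if a selected entry is zero.
  -- Thresholding uses `T`, least squares uses `S'`.
  obtain ⟨_, ⟨T, hT, htop, rfl⟩, hS'eq⟩ := hS'
  have hTk : T.card ≤ k := hT.le.trans (min_le_left _ _)
  have hE := fun (R : Finset (Fin n)) (hR : R.card ≤ k) =>
    norm_restrictTo_newtonUpdate_sub_le hk A hlam hΩ.card_le hδq hlower hupper hy
      (V := S ∪ S₀) ((Finset.card_union_le _ _).trans (by omega))
      ((suppSubmodule (S ∪ S₀)).sub_mem
        (mem_suppSubmodule.2 (hxS.trans Finset.subset_union_left))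
        (mem_suppSubmodule.2 (hx.trans Finset.subset_union_right))) hR
  rw [← hu] at hE
  have h1 := norm_restrictTo_sub_relaxed_le hk A hδ.le hy hS hxS
    (Finset.subset_union_left (s₂ := T)) ((Finset.card_union_le _ _).trans (by omega)) hw hE
  have h2 := norm_sub_restrictTo_top_le hxS hS hT htop
  have h3 := norm_sub_leastSquares_le A hδ hy hS hS'card hxS hS'eq.ge hx'
  rw [norm_sub_rev]
  refine h3.trans ?_
  set e := ‖x - xS‖
  set G := ric A (3 * k) + stepDelta lam (ric A q) * (1 + sqrtCeil n k * ric A (3 * k)) with hG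
  set P := ‖restrictTo (S ∪ T) (xS - hadamard w u)‖
  set Q := ‖xS - restrictTo T (hadamard w u)‖
  have hd := ric_nonneg A (2 * k)
  have hdk := ric_nonneg A k
  have hkk : ric A k ≤ ric A (2 * k) := ric_mono A (by omega)
  have hφ := Real.goldenRatio_pos
  have hG0 : 0 ≤ G := by
    have := ric_nonneg A (3 * k)
    have := stepDelta_nonneg lam (ric A q)
    have : 0 ≤ sqrtCeil n k := Real.sqrt_nonneg _
    positivity
  have ha : 0 < 1 - ric A (2 * k) := by linarith
  have hb : 0 < 1 + ric A (2 * k) := by linarith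
  have hra := Real.sqrt_pos.2 ha
  have hrb := Real.sqrt_pos.2 hb
  have hfac : √(1 - ric A (2 * k) ^ 2) = √(1 - ric A (2 * k)) * √(1 + ric A (2 * k)) := by
    rw [← Real.sqrt_mul ha.le]
    ring_nf
  have hra2 : √(1 - ric A (2 * k)) * √(1 - ric A (2 * k)) = 1 - ric A (2 * k) :=
    Real.mul_self_sqrt ha.le
  have hrk2 : √(1 + ric A k) * √(1 + ric A k) = 1 + ric A k :=
    Real.mul_self_sqrt (by linarith)
  have hrk : √(1 + ric A k) ≤ √(1 + ric A (2 * k)) := Real.sqrt_le_sqrt (by linarith)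
  have hP : P ≤ (3 * √(1 + ric A (2 * k)) * (G * e) + 3 * (1 + ric A k) *
      (lam * (1 / (1 - ric A q)) * (sqrtCeil n k * ‖η‖)) + 2 * ‖η‖) /
        √(1 - ric A (2 * k)) := by
    rw [le_div_iff₀ hra, mul_comm]
    refine h1.trans ?_
    -- Weakening `δ_k` to `δ_{2k}` here lets the root cancel against the factor of `√(1-δ_{2k}²)`;
    -- the noise term keeps `δ_k`.
    have h4 : √(1 + ric A k) * (G * e) ≤ √(1 + ric A (2 * k)) * (G * e) :=
      mul_le_mul_of_nonneg_right hrk (mul_nonneg hG0 (norm_nonneg _))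
    have h5 := congrArg (· * (lam * (1 / (1 - ric A q)) * (sqrtCeil n k * ‖η‖))) hrk2
    linarith
  have hQ : Q / √(1 - ric A (2 * k) ^ 2) ≤ Real.goldenRatio *
      ((3 * √(1 + ric A (2 * k)) * (G * e) + 3 * (1 + ric A k) *
      (lam * (1 / (1 - ric A q)) * (sqrtCeil n k * ‖η‖)) + 2 * ‖η‖) /
        √(1 - ric A (2 * k))) / (√(1 - ric A (2 * k)) * √(1 + ric A (2 * k))) := by
    rw [hfac]
    exact div_le_div_of_nonneg_right (h2.trans (mul_le_mul_of_nonneg_left hP hφ.le))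
      (by positivity)
  refine (add_le_add_left hQ _).trans (le_of_eq ?_)
  have hq : 1 - ric A q ≠ 0 := by linarith
  rw [rho4, tau4, ← hG]
  generalize √(1 - ric A (2 * k)) = ra at hra hra2 ⊢
  generalize Real.goldenRatio = φ
  rw [← hra2]
  field_simp
  ring

/-! ### Parameter conditions and convergence. -/

/-- The threshold is used only to make the isometry constants less than `1`. For `c = 0` the
quotient is `0` by convention. -/
theorem cnotp_ric_bound_le_one {c : ℝ} (hc : 0 ≤ c) :
    (-(1 + 6 * Real.goldenRatio) +
        √((1 + 6 * Real.goldenRatio) ^ 2 + 12 * Real.goldenRatio * c)) /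
      (6 * Real.goldenRatio * c) ≤ 1 := by
  have hφ := Real.goldenRatio_pos
  refine div_le_one_of_le₀ ?_ (by positivity)
  have : √((1 + 6 * Real.goldenRatio) ^ 2 + 12 * Real.goldenRatio * c) ≤
      (1 + 6 * Real.goldenRatio) + 6 * Real.goldenRatio * c := by
    rw [Real.sqrt_le_left (by positivity)]
    have : 0 ≤ Real.goldenRatio ^ 2 * c := by positivity
    nlinarith [sq_nonneg (6 * Real.goldenRatio * c)]
  linarith

theorem stepDelta_lt {lam δ κ : ℝ} (hδ0 : 0 ≤ δ) (hδ : δ < 1) (hlam : 0 ≤ lam)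
    (hlower : (1 + δ) * (1 - κ) < lam) (hupper : lam < (1 - δ) * (1 + κ)) :
    stepDelta lam δ < κ := by
  have hp : 0 < 1 + δ := by linarith
  have hm : 0 < 1 - δ := by linarith
  have h1 : 1 - κ < lam / (1 + δ) := by rw [lt_div_iff₀ hp]; linarith
  have h2 : lam / (1 - δ) < 1 + κ := by rw [div_lt_iff₀ hm]; linarith
  have h3 : lam / (1 + δ) ≤ lam / (1 - δ) := div_le_div_of_nonneg_left hlam hm (by linarith)
  rw [stepDelta, max_lt_iff, abs_lt, abs_lt]
  refine ⟨⟨?_, ?_⟩, ?_, ?_⟩ <;> linarith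

theorem mainTheorem4 {m n : ℕ} (k q : ℕ) (hk : 0 < k) (hkq : k ≤ q)
    (A : Matrix (Fin m) (Fin n) ℝ)
    (x : EuclideanSpace ℝ (Fin n)) (η y : EuclideanSpace ℝ (Fin m))
    (hy : y = mulE A x + η)
    (S : Finset (Fin n)) (hS : IsThresholdSupport k x S)
    (xS : EuclideanSpace ℝ (Fin n)) (hxS : xS = restrictTo S x)
    (η' : EuclideanSpace ℝ (Fin m)) (hη' : η' = mulE A (restrictTo Sᶜ x) + η)
    (hδ : ric A (max q (3 * k)) <
      (-(1 + 6 * Real.goldenRatio) +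
          √((1 + 6 * Real.goldenRatio) ^ 2 + 12 * Real.goldenRatio * sqrtCeil n k)) /
        (6 * Real.goldenRatio * sqrtCeil n k))
    (lam α γ : ℝ) (hα : 0 < α) (hγ : 0 < γ)
    (hlam_lower : (1 + ric A q) *
        (1 - (1 / (3 * Real.goldenRatio) * (1 - ric A (2 * k)) - ric A (3 * k)) /
          (1 + sqrtCeil n k * ric A (3 * k))) < lam)
    (hlam_upper : lam < (1 - ric A q) *
        (1 + (1 / (3 * Real.goldenRatio) * (1 - ric A (2 * k)) - ric A (3 * k)) /
          (1 + sqrtCeil n k * ric A (3 * k))))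
    (hαγ_lower : 1 / (1 + ric A q) ≤ α * γ)
    (hαγ_upper : α * γ ≤ 1 / (1 - ric A q)) :
    rho4 A k q lam < 1 ∧
    ∀ X : ℕ → EuclideanSpace ℝ (Fin n), IsCNOTPSequence A y k q lam α γ X →
      (∀ p, ‖X (p + 1) - xS‖ ≤ rho4 A k q lam * ‖X p - xS‖ + tau4 A k q lam * ‖η'‖) ∧
      (η' = 0 → Filter.Tendsto X Filter.atTop (nhds xS)) := by
  have hφ := Real.goldenRatio_pos
  have hφ1 := Real.one_lt_goldenRatio
  have hc : 0 ≤ sqrtCeil n k := Real.sqrt_nonneg _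
  have hδ1 : ric A (max q (3 * k)) < 1 := hδ.trans_le (cnotp_ric_bound_le_one hc)
  have hδq : ric A q < 1 := (ric_mono A (le_max_left _ _)).trans_lt hδ1
  have hδ3 : ric A (3 * k) < 1 := (ric_mono A (le_max_right _ _)).trans_lt hδ1
  have hδ2 : ric A (2 * k) < 1 := (ric_mono A (by omega)).trans_lt hδ3
  have hq0 := ric_nonneg A q
  have h20 := ric_nonneg A (2 * k)
  have h30 := ric_nonneg A (3 * k)
  have hden : 0 < 1 + sqrtCeil n k * ric A (3 * k) := by positivity
  have ha : 0 < 1 - ric A (2 * k) := by linarith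
  set κ := (1 / (3 * Real.goldenRatio) * (1 - ric A (2 * k)) - ric A (3 * k)) /
    (1 + sqrtCeil n k * ric A (3 * k)) with hκ
  -- This makes the lower end of the window nonnegative, hence `λ ≥ 0`.
  have hκ1 : κ ≤ 1 := by
    refine div_le_one_of_le₀ ?_ hden.le
    have h1 : 1 / (3 * Real.goldenRatio) ≤ 1 := by
      rw [div_le_one (by positivity)]
      linarith
    have h2 : 1 / (3 * Real.goldenRatio) * (1 - ric A (2 * k)) ≤ 1 :=
      mul_le_one₀ h1 ha.le (by linarith)
    have h3 : 0 ≤ sqrtCeil n k * ric A (3 * k) := mul_nonneg hc h30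
    linarith
  have hlam : 0 ≤ lam :=
    (mul_nonneg (by linarith) (by linarith : (0 : ℝ) ≤ 1 - κ)).trans hlam_lower.le
  have hΔ := stepDelta_lt hq0 hδq hlam hlam_lower hlam_upper
  have hΔ0 := stepDelta_nonneg lam (ric A q)
  have hρ : rho4 A k q lam < 1 := by
    -- With denominators cleared, `Δ < κ` is exactly `ρ₄ < 1`.
    rw [hκ, lt_div_iff₀ hden, one_div_mul_eq_div] at hΔ
    rw [rho4, div_mul_eq_mul_div, div_lt_one ha, ← lt_div_iff₀' (by positivity)]
    linarith
  have hρ0 : 0 ≤ rho4 A k q lam := by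
    unfold rho4
    positivity
  refine ⟨hρ, fun X hX => ?_⟩
  have hxS' : supp xS ⊆ S := hxS ▸ supp_restrictTo_subset S x
  have hy' : y = mulE A xS + η' := by
    rw [hy, hη', hxS, ← add_assoc, ← mulE_add, restrictTo_add_compl]
  have hsupp : ∀ p, ∃ R : Finset (Fin n), R.card ≤ k ∧ supp (X p) ⊆ R := by
    rintro (_ | p)
    · exact ⟨∅, by simp, by simp [hX.1, supp]⟩
    · exact (hX.2 p).exists_supp_subset
  have hstep : ∀ p, ‖X (p + 1) - xS‖ ≤
      rho4 A k q lam * ‖X p - xS‖ + tau4 A k q lam * ‖η'‖ := by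
    intro p
    obtain ⟨R, hR, hXR⟩ := hsupp p
    exact (hX.2 p).norm_sub_le hk hlam hδq hδ2 hαγ_lower hαγ_upper hy' hS.card_le hxS' hR hXR
  refine ⟨hstep, fun hη0 => ?_⟩
  have hgeom : ∀ p, ‖X p - xS‖ ≤ rho4 A k q lam ^ p * ‖X 0 - xS‖ := by
    intro p
    induction p with
    | zero => simp
    | succ p ih =>
      refine (hstep p).trans ?_
      rw [hη0, norm_zero, mul_zero, add_zero, pow_succ', mul_assoc]
      exact mul_le_mul_of_nonneg_left ih hρ0
  rw [tendsto_iff_norm_sub_tendsto_zero]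
  refine squeeze_zero (fun _ => norm_nonneg _) hgeom ?_
  simpa using (tendsto_pow_atTop_nhds_zero_of_lt_one hρ0 hρ).mul_const ‖X 0 - xS‖
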